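/- Let $d\in\{2,3\}$, let $\Lambda\subset\mathbb R^d$ be a bounded, open, connected, polygonal (polyhedral) set with outward unit normal $\vec n$, and let $T>0$. Let $(\Omega,\mathcal A,\mathbb P)$ be a probability space with a right-continuous, complete filtration $(\mathcal F_t)_{t\ge0}$ and let $W$ be a standard one-dimensional Brownian motion with respect to $(\mathcal F_t)_{t\ge 0}$. Let $g,f,\beta\in C^2(\mathbb R)$ have bounded first and second derivatives, let $f$ be non-decreasing, and let $f(0)=\beta(0)=0$. Let $\mathbf v:[0,T]\times\overline\Lambda\to\mathbb R^d$ be continuous, of class $C^1$ on $[0,T]\times\Lambda$, with $\operatorname{div}\mathbf v=0$ in $[0,T]\times\Lambda$ and $\mathbf v\cdot\vec n=0$ on $[0,T]\times\partial\Lambda$. For $N\in\mathbb N$ put $\tau=T/N$, $t_n=n\tau$, $\Delta_nW=W(t_n)-W(t_{n-1})$ and $\mathbf v^n=\mathbf v(t_n,\cdot)$. Given an $\mathcal F_0$-measurable $v^0$ with values in $H^1(\Lambda)$, let $v^n\in L^2(\Omega;H^1(\Lambda))$, $n=1,\dots,N$, be the $\mathcal F_{t_n}$-measurable weak solutions of the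 semi-implicit Euler scheme $$v^n-v^{n-1}-\tau\Delta v^n+\tau\operatorname{div}(\mathbf v^nf(v^n))=g(v^{n-1})\,\Delta_nW+\tau\beta(v^n)\ \text{ in }\Omega\times\Lambda,\qquad \nabla v^n\cdot\vec n=0\ \text{ on }\Omega\times\partial\Lambda,$$ where $\Delta$ is the Laplace operator on $H^1(\Lambda)$ associated with the weak formulation of the homogeneous Neumann boundary condition, and where $\|u\|_{H^1}^2=\|u\|_2^2+\|\nabla u\|_2^2$. Let $r\in\mathbb N_0$. Then there are $\tilde N_r\in\mathbb N$, $\tilde N_r>0$, and $\hat C(r)>0$, depending only on $r,d,\Lambda,T,g,f,\beta,\mathbf v$, such that for every $\mathcal F_0$-measurable $v^0\in L^{2^{r+1}}(\Omega;H^1(\Lambda))$ there is $\tilde K_2(r)>0$ such that for all $N\ge\tilde N_r$ $$\sup_{1\le n\le N}\mathbb E\big[\|v^n\|_{H^1}^{2^{r+1}}\big]+\sum_{n=1}^N\mathbb E\Big[\prod_{l=1}^r\Big(\|v^n\|_{H^1}^{2^l}+\|v^{n-1}\|_{H^1}^{2^l}\Big)\Big(\|v^n-v^{n-1}\|_{H^1}^2+\tau\|\Delta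 v^n\|_2^2\Big)\Big]\le\hat C(r)\Big(|g(0)|^{2^{r+1}}+\mathbb E\big[\|v^0\|_{H^1}^{2^{r+1}}\big]\Big)\le\tilde K_2(r).$$ -/

import Mathlib

open MeasureTheory ProbabilityTheory Set
open scoped NNReal ENNReal

noncomputable section

/-- The Euclidean space of dimension `d`. -/
abbrev Euc (d : ℕ) : Type := EuclideanSpace ℝ (Fin d)

/-! ### The domain and its outward unit normal -/

/-- A polygonal (polyhedral) set: the interior of a finite union of convex polytopes. -/
def IsPolygonal {d : ℕ} (Λ : Set (Euc d)) : Prop :=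
  ∃ 𝒮 : Finset (Finset (Euc d)), Λ = interior (⋃ S ∈ 𝒮, convexHull ℝ (S : Set (Euc d)))

/-- `ν` is the outward unit normal of `Λ` at `x`: near `x` the set `Λ` is the open half-space
with outward unit normal `ν`. For a polygonal set this determines the normal at the boundary
points in the relative interior of the faces, and there is none on the lower-dimensional edges. -/
def IsOutwardNormal {d : ℕ} (Λ : Set (Euc d)) (x ν : Euc d) : Prop :=
  ‖ν‖ = 1 ∧ ∃ ε > 0, ∀ y ∈ Metric.ball x ε, y ∈ Λ ↔ inner ℝ (y - x) ν < 0

/-! ### The Sobolev space `H¹(Λ)` -/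

/-- The function `φ` is a smooth function with compact support in `Λ`. -/
def IsTest {d : ℕ} (Λ : Set (Euc d)) (φ : Euc d → ℝ) : Prop :=
  ContDiff ℝ (⊤ : ℕ∞) φ ∧ HasCompactSupport φ ∧ tsupport φ ⊆ Λ

/-- The space `L²(Λ)` with values in `F`. -/
abbrev L2 {d : ℕ} (Λ : Set (Euc d)) (F : Type) [NormedAddCommGroup F] : Type :=
  Lp F 2 (volume.restrict Λ)

/-- `G` is the weak gradient of `u` in `Λ`. -/
def IsWeakGradient {d : ℕ} (Λ : Set (Euc d)) (u : Euc d → ℝ) (G : Euc d → Euc d) : Prop :=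
  ∀ φ, IsTest Λ φ → ∫ x in Λ, u x • gradient φ x = -∫ x in Λ, φ x • G x

/-- `D` is the weak divergence of the vector field `F` in `Λ`. -/
def IsWeakDivergence {d : ℕ} (Λ : Set (Euc d)) (F : Euc d → Euc d) (D : Euc d → ℝ) : Prop :=
  ∀ φ, IsTest Λ φ → ∫ x in Λ, inner ℝ (F x) (gradient φ x) = -∫ x in Λ, D x * φ x

lemma IsTest.memLp {d : ℕ} {Λ : Set (Euc d)} {φ : Euc d → ℝ} (h : IsTest Λ φ) :
    MemLp φ 2 (volume.restrict Λ) :=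
  (h.1.continuous.memLp_of_hasCompactSupport h.2.1).restrict _

lemma IsTest.memLp_gradient {d : ℕ} {Λ : Set (Euc d)} {φ : Euc d → ℝ} (h : IsTest Λ φ) :
    MemLp (gradient φ) 2 (volume.restrict Λ) := by
  have hc : Continuous (gradient φ) :=
    (InnerProductSpace.toDual ℝ (Euc d)).symm.continuous.comp
      (h.1.continuous_fderiv (by simp))
  have hs : HasCompactSupport (gradient φ) :=
    (h.2.1.fderiv (𝕜 := ℝ)).comp_left (g := (InnerProductSpace.toDual ℝ (Euc d)).symm)
      (map_zero _)
  exact (hc.memLp_of_hasCompactSupport hs).restrict _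

lemma IsTest.integrable_smul_gradient {d : ℕ} {Λ : Set (Euc d)} {φ : Euc d → ℝ}
    (h : IsTest Λ φ) (u : L2 Λ ℝ) :
    Integrable (fun x => u x • gradient φ x) (volume.restrict Λ) :=
  memLp_one_iff_integrable.1 (h.memLp_gradient.smul (Lp.memLp u))

lemma IsTest.integrable_smul {d : ℕ} {Λ : Set (Euc d)} {φ : Euc d → ℝ}
    (h : IsTest Λ φ) (G : L2 Λ (Euc d)) :
    Integrable (fun x => φ x • G x) (volume.restrict Λ) :=
  memLp_one_iff_integrable.1 ((Lp.memLp G).smul h.memLp)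

/-- The Sobolev space `H¹(Λ)`: the pairs `(u, ∇u)` of a function `u ∈ L²(Λ)` and its weak gradient
`∇u ∈ L²(Λ; ℝᵈ)`. The norm inherited from the Hilbert sum `L²(Λ) ⊕ L²(Λ; ℝᵈ)` satisfies
`‖u‖² = ‖u‖₂² + ‖∇u‖₂²`. -/
def H1 {d : ℕ} (Λ : Set (Euc d)) : Submodule ℝ (WithLp 2 (L2 Λ ℝ × L2 Λ (Euc d))) where
  carrier := {p | IsWeakGradient Λ p.fst p.snd}
  add_mem' := by
    intro a b ha hb φ hφ
    have e1 : ∫ x in Λ, ((a + b).fst : Euc d → ℝ) x • gradient φ x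
        = ∫ x in Λ, (a.fst x • gradient φ x + b.fst x • gradient φ x) := by
      refine integral_congr_ae ?_
      filter_upwards [Lp.coeFn_add a.fst b.fst] with x hx
      rw [WithLp.add_fst, hx, Pi.add_apply, add_smul]
    have e2 : ∫ x in Λ, φ x • ((a + b).snd : Euc d → Euc d) x
        = ∫ x in Λ, (φ x • a.snd x + φ x • b.snd x) := by
      refine integral_congr_ae ?_
      filter_upwards [Lp.coeFn_add a.snd b.snd] with x hx
      rw [WithLp.add_snd, hx, Pi.add_apply, smul_add]
    rw [e1, e2, integral_add (hφ.integrable_smul_gradient _) (hφ.integrable_smul_gradient _),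
      integral_add (hφ.integrable_smul _) (hφ.integrable_smul _), ha φ hφ, hb φ hφ, neg_add]
  zero_mem' := by
    intro φ _
    have e1 : ∫ x in Λ, ((0 : WithLp 2 (L2 Λ ℝ × L2 Λ (Euc d))).fst : Euc d → ℝ) x • gradient φ x
        = 0 := by
      refine integral_eq_zero_of_ae ?_
      filter_upwards [Lp.coeFn_zero ℝ 2 (volume.restrict Λ)] with x hx
      rw [WithLp.zero_fst, hx, Pi.zero_apply, zero_smul]; rfl
    have e2 : ∫ x in Λ, φ x • ((0 : WithLp 2 (L2 Λ ℝ × L2 Λ (Euc d))).snd : Euc d → Euc d) x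
        = 0 := by
      refine integral_eq_zero_of_ae ?_
      filter_upwards [Lp.coeFn_zero (Euc d) 2 (volume.restrict Λ)] with x hx
      rw [WithLp.zero_snd, hx, Pi.zero_apply, smul_zero]
    rw [e1, e2, neg_zero]
  smul_mem' := by
    intro c a ha φ hφ
    have e1 : ∫ x in Λ, ((c • a).fst : Euc d → ℝ) x • gradient φ x
        = ∫ x in Λ, c • (a.fst x • gradient φ x) := by
      refine integral_congr_ae ?_
      filter_upwards [Lp.coeFn_smul c a.fst] with x hx
      rw [WithLp.smul_fst, hx, Pi.smul_apply, smul_assoc]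
    have e2 : ∫ x in Λ, φ x • ((c • a).snd : Euc d → Euc d) x
        = ∫ x in Λ, c • (φ x • a.snd x) := by
      refine integral_congr_ae ?_
      filter_upwards [Lp.coeFn_smul c a.snd] with x hx
      rw [WithLp.smul_snd, hx, Pi.smul_apply, smul_comm]
    rw [e1, e2, integral_smul, integral_smul, ha φ hφ, smul_neg]

/-- The function underlying an element of `H¹(Λ)`. -/
def H1fn {d : ℕ} {Λ : Set (Euc d)} (u : H1 Λ) : L2 Λ ℝ := u.1.fst

/-- The weak gradient of an element of `H¹(Λ)`. -/
def H1grad {d : ℕ} {Λ : Set (Euc d)} (u : H1 Λ) : L2 Λ (Euc d) := u.1.snd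

/-- `z = Δu` in `L²(Λ)`, where `Δ` is the Laplace operator on `H¹(Λ)` associated with the weak
formulation of the homogeneous Neumann boundary condition. -/
def IsNeumannLaplacian {d : ℕ} {Λ : Set (Euc d)} (u : H1 Λ) (z : L2 Λ ℝ) : Prop :=
  ∀ w : H1 Λ, ∫ x in Λ, z x * H1fn w x = -∫ x in Λ, inner ℝ (H1grad u x) (H1grad w x)

/-- The norm `‖Δu‖₂` in `[0, ∞]`; it is `∞` if `Δu` does not belong to `L²(Λ)`. -/
def laplacianNorm {d : ℕ} {Λ : Set (Euc d)} (u : H1 Λ) : ℝ≥0∞ :=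
  ⨅ z : L2 Λ ℝ, ⨅ _ : IsNeumannLaplacian u z, ‖z‖ₑ

/-! ### The data -/

/-- A `C²` function on the real line with bounded first and second derivatives. -/
def IsC2Bounded (g : ℝ → ℝ) : Prop :=
  ContDiff ℝ 2 g ∧ (∃ M, ∀ x, |deriv g x| ≤ M) ∧ ∃ M, ∀ x, |deriv (deriv g) x| ≤ M

/-- The divergence of a vector field. -/
def divergence {d : ℕ} (F : Euc d → Euc d) (x : Euc d) : ℝ :=
  ∑ i, fderiv ℝ F x (EuclideanSpace.single i 1) i

/-- An admissible velocity field: `C¹` on `[0,T] × Λ` and continuous up to the boundary,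
divergence free in `[0,T] × Λ`, with vanishing normal component on `[0,T] × ∂Λ`. -/
structure IsVelocity {d : ℕ} (Λ : Set (Euc d)) (T : ℝ) (vel : ℝ → Euc d → Euc d) : Prop where
  contDiffOn : ContDiffOn ℝ 1 (Function.uncurry vel) (Icc 0 T ×ˢ Λ)
  continuousOn : ContinuousOn (Function.uncurry vel) (Icc 0 T ×ˢ closure Λ)
  div_eq_zero : ∀ t ∈ Icc 0 T, ∀ x ∈ Λ, divergence (vel t) x = 0
  normal_eq_zero : ∀ t ∈ Icc 0 T, ∀ x ∈ frontier Λ, ∀ ν, IsOutwardNormal Λ x ν →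
    inner ℝ (vel t x) ν = 0

/-! ### The noise -/

/-- The filtration `F` is right-continuous and complete. -/
def UsualConditions {Ω : Type*} {mΩ : MeasurableSpace Ω} (F : Filtration ℝ≥0 mΩ)
    (P : Measure Ω) : Prop :=
  F.IsRightContinuous ∧ ∀ A : Set Ω, P A = 0 → MeasurableSet[F 0] A

/-- `W` is a standard one-dimensional Brownian motion with respect to the filtration `F`. -/
structure IsBrownianFor {Ω : Type*} {mΩ : MeasurableSpace Ω} (F : Filtration ℝ≥0 mΩ)
    (W : ℝ≥0 → Ω → ℝ) (P : Measure Ω) : Prop where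
  isBrownian : IsBrownianReal W P
  adapted : ∀ t, Measurable[F t] (W t)
  indep : ∀ s t, s ≤ t →
    Indep (MeasurableSpace.comap (fun ω => W t ω - W s ω) inferInstance) (F s) P

/-! ### The semi-implicit Euler scheme -/

/-- The grid point `t_n = n T / N`. -/
def gridTime (T : ℝ) (N n : ℕ) : ℝ := n * T / N

/-- One step of the scheme, for a fixed realization, in the weak sense: the function `u` solves
`u - u' - τ Δu + τ div(b f(u)) = g(u') δ + τ β(u)` in `Λ`, with `∇u · n = 0` on `∂Λ`,
where `u'` is the previous iterate and `δ` the increment of the noise. -/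
def IsEulerStep {d : ℕ} (Λ : Set (Euc d)) (τ δ : ℝ) (g f β : ℝ → ℝ) (b : Euc d → Euc d)
    (u' u : H1 Λ) : Prop :=
  ∃ D : L2 Λ ℝ, IsWeakDivergence Λ (fun x => f (H1fn u x) • b x) D ∧
    ∀ w : H1 Λ,
      (∫ x in Λ, (H1fn u x - H1fn u' x) * H1fn w x) + τ * (∫ x in Λ, inner ℝ (H1grad u x) (H1grad w x))
          + τ * (∫ x in Λ, D x * H1fn w x)
        = (∫ x in Λ, g (H1fn u' x) * δ * H1fn w x) + τ * ∫ x in Λ, β (H1fn u x) * H1fn w x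

/-- `v 0, …, v N` are the iterates of the semi-implicit Euler scheme with `N` time steps and initial
value `v0`: for `1 ≤ n ≤ N`, `v n ∈ L²(Ω; H¹(Λ))` is `F_{t_n}`-measurable and solves the
`n`-th step almost surely. -/
structure IsEulerScheme {d : ℕ} (Λ : Set (Euc d)) (T : ℝ) (g f β : ℝ → ℝ)
    (vel : ℝ → Euc d → Euc d) {Ω : Type*} {mΩ : MeasurableSpace Ω} (P : Measure Ω)
    (F : Filtration ℝ≥0 mΩ) (W : ℝ≥0 → Ω → ℝ) (v0 : Ω → H1 Λ) (N : ℕ)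
    (v : ℕ → Ω → H1 Λ) : Prop where
  init : v 0 = v0
  measurable : ∀ n ∈ Finset.Icc 1 N, StronglyMeasurable[F (gridTime T N n).toNNReal] (v n)
  memLp : ∀ n ∈ Finset.Icc 1 N, MemLp (v n) 2 P
  step : ∀ n ∈ Finset.Icc 1 N, ∀ᵐ ω ∂P,
    IsEulerStep Λ (T / N)
      (W (gridTime T N n).toNNReal ω - W (gridTime T N (n - 1)).toNNReal ω)
      g f β (vel (gridTime T N n)) (v (n - 1) ω) (v n ω)

end

/-! The proof is an energy estimate in `H¹(Λ)`, raised to a power before the expectation is taken.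
Write `u = v^n`, `u' = v^{n-1}`, `δ` for the increment and `G = g(u')`.

One step. Because `b` is divergence free, the transport term is `f'(u) b·∇u`, bounded in `L²` by
`‖∇u‖` (`norm_weakDivergence_le`, from a chain rule proved by mollification). The scheme then
determines `Δu` in `L²`. Test it with `u` and with `-Δu` and add: the time differences form the `H¹`
product `⟨u - u', u⟩`, and since `G ∈ H¹(Λ)` the noise becomes `δ⟨G, u⟩` in `H¹`, with no second
derivative. Young's inequality gives (`IsEulerStep.energy`) `‖u‖² - ‖u'‖² + ‖u - u'‖² + τ‖Δu‖² ≤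
2δ⟨G, u⟩ + C₀τ‖u‖²`.

Powers. Multiply by the product `Q` of the theorem: `(‖u‖² - ‖u'‖²) Q` telescopes to a difference of
powers `2^(r+1)`. As `Q` depends on `u`, the noise is not centred. Write `Q⟨G, u⟩ = Q⟨G, u - u'⟩ +
(Q - Q₀)⟨G, u'⟩ + Q₀⟨G, u'⟩`, where `Q₀` is `Q` with `u` replaced by `u'`. The first two terms
contain a factor `‖u - u'‖`; they are absorbed at the cost of a remainder with factor `δ²`. For
small `τ` the norm of `u` is controlled by `u'` and `δ`, so the whole remainder is at most a
function of `δ` times a function of `u'` (`exists_energy_pow`).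

Expectation. `δ` is independent of the past: the `Q₀` term has mean zero, the function of `δ` has
mean `O(τ)` (`exists_gaussian_moment_le`, `lintegral_energy_le`). The discrete Gronwall inequality
`energy_gronwall` concludes. -/

noncomputable section

/-! ### Mollification -/

open Filter Topology in
/-- Nonnegative integrable functions that converge almost everywhere, with constant integral equal
to that of the limit, converge in `L¹`. -/
lemma tendsto_integral_abs_sub_of_nonneg {α : Type*} {mα : MeasurableSpace α} {μ : Measure α}
    {F : ℕ → α → ℝ} {f : α → ℝ} (hF : ∀ n, Integrable (F n) μ) (hf : Integrable f μ)
    (hF0 : ∀ n x, 0 ≤ F n x) (hf0 : ∀ x, 0 ≤ f x) (hint : ∀ n, ∫ x, F n x ∂μ = ∫ x, f x ∂μ)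
    (hlim : ∀ᵐ x ∂μ, Tendsto (fun n => F n x) atTop (𝓝 (f x))) :
    Tendsto (fun n => ∫ x, |F n x - f x| ∂μ) atTop (𝓝 0) := by
  -- Scheffé's argument: `|a| = a + 2a⁻` with `a = F n - f`. The integral of `a` vanishes, and `a⁻ ≤
  -- f` allows dominated convergence.
  have key : ∀ n, ∫ x, |F n x - f x| ∂μ = 2 * ∫ x, max (f x - F n x) 0 ∂μ := by
    intro n
    have hi : Integrable (fun x => max (f x - F n x) 0) μ := (hf.sub (hF n)).pos_part
    have : ∀ x, |F n x - f x| = (F n x - f x) + 2 * max (f x - F n x) 0 := by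
      intro x
      rcases le_total (F n x) (f x) with h | h
      · rw [abs_of_nonpos (by linarith), max_eq_left (by linarith)]; ring
      · rw [abs_of_nonneg (by linarith), max_eq_right (by linarith)]; ring
    have hs : Integrable (fun x => F n x - f x) μ := (hF n).sub hf
    simp_rw [this]
    rw [integral_add hs (hi.const_mul 2), integral_sub (hF n) hf, hint n, sub_self,
      zero_add, integral_const_mul]
  simp_rw [key]
  have h0 : Tendsto (fun n => ∫ x, max (f x - F n x) 0 ∂μ) atTop (𝓝 (∫ _, (0 : ℝ) ∂μ)) := by
    refine tendsto_integral_of_dominated_convergence f (fun n => ?_) hf (fun n => ?_) ?_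
    · exact (hf.sub (hF n)).pos_part.aestronglyMeasurable
    · refine Eventually.of_forall fun x => ?_
      rw [Real.norm_of_nonneg (le_max_right _ _)]
      exact max_le (by linarith [hF0 n x]) (hf0 x)
    · filter_upwards [hlim] with x hx
      have := (tendsto_const_nhds (x := f x)).sub hx
      rw [sub_self] at this
      simpa using this.max (tendsto_const_nhds (x := (0 : ℝ)))
  simpa using h0.const_mul 2

/-- The standard bump functions with support in the ball of radius `1 / (n + 1)`. -/
def mollifier (d n : ℕ) : ContDiffBump (0 : Euc d) where
  rIn := 1 / (2 * ((n : ℝ) + 1))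
  rOut := 1 / ((n : ℝ) + 1)
  rIn_pos := by positivity
  rIn_lt_rOut := by
    apply one_div_lt_one_div_of_lt <;> linarith [(Nat.cast_nonneg n : (0 : ℝ) ≤ n)]

/-- The mollification of a function. -/
def mollify {d : ℕ} (n : ℕ) (h : Euc d → ℝ) : Euc d → ℝ :=
  convolution ((mollifier d n).normed volume) h (ContinuousLinearMap.lsmul ℝ ℝ) volume

section Mollify

open Filter Topology

variable {d : ℕ} {h : Euc d → ℝ}

lemma tendsto_mollifier_rOut : Tendsto (fun n => (mollifier d n).rOut) atTop (𝓝 0) :=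
  tendsto_one_div_add_atTop_nhds_zero_nat

lemma ae_tendsto_mollify (hh : Integrable h) :
    ∀ᵐ x, Tendsto (fun n => mollify n h x) atTop (𝓝 (h x)) := by
  -- The radii of the bumps must stay comparable; here `rOut = 2 * rIn`.
  refine ContDiffBump.ae_convolution_tendsto_right_of_locallyIntegrable (K := 2)
    tendsto_mollifier_rOut (Eventually.of_forall fun n => ?_) hh.locallyIntegrable
  simp only [mollifier]
  rw [one_div, one_div, mul_inv, mul_inv_cancel_left₀ two_ne_zero]

lemma integrable_mollifier (n : ℕ) : Integrable ((mollifier d n).normed volume) :=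
  (mollifier d n).integrable_normed

lemma integrable_mollify (hh : Integrable h) (n : ℕ) : Integrable (mollify n h) :=
  (integrable_mollifier n).integrable_convolution _ hh

lemma integral_mollify (hh : Integrable h) (n : ℕ) : ∫ x, mollify n h x = ∫ x, h x := by
  rw [mollify, integral_convolution _ (integrable_mollifier n) hh, ContDiffBump.integral_normed]
  simp

lemma mollify_nonneg (hh : ∀ x, 0 ≤ h x) (n : ℕ) (x : Euc d) : 0 ≤ mollify n h x := by
  rw [mollify, convolution_def]
  exact integral_nonneg fun t => mul_nonneg ((mollifier d n).nonneg_normed t) (hh _)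

lemma convolutionExists_mollifier (hh : Integrable h) (n : ℕ) :
    ConvolutionExists ((mollifier d n).normed volume) h (ContinuousLinearMap.lsmul ℝ ℝ) volume :=
  HasCompactSupport.convolutionExists_left _ (mollifier d n).hasCompactSupport_normed
    (mollifier d n).continuous_normed hh.locallyIntegrable

lemma mollify_sub {h₁ h₂ : Euc d → ℝ} (hh₁ : Integrable h₁) (hh₂ : Integrable h₂) (n : ℕ)
    (x : Euc d) : mollify n (fun y => h₁ y - h₂ y) x = mollify n h₁ x - mollify n h₂ x := by
  rw [mollify, mollify, mollify, convolution_def, convolution_def, convolution_def,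
    ← integral_sub (convolutionExists_mollifier hh₁ n x) (convolutionExists_mollifier hh₂ n x)]
  refine integral_congr_ae (Eventually.of_forall fun t => ?_)
  simp [mul_sub]

/-- Mollifications converge in `L¹`. -/
lemma tendsto_integral_abs_mollify_sub (hh : Integrable h) :
    Tendsto (fun n => ∫ x, |mollify n h x - h x|) atTop (𝓝 0) := by
  -- Mollification preserves sign and integral, so Scheffé's lemma applies to the positive and the
  -- negative part of `h` separately.
  have main : ∀ {k : Euc d → ℝ}, Integrable k → (∀ x, 0 ≤ k x) →
      Tendsto (fun n => ∫ x, |mollify n k x - k x|) atTop (𝓝 0) := fun {k} hk hk0 =>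
    tendsto_integral_abs_sub_of_nonneg (integrable_mollify hk) hk (mollify_nonneg hk0) hk0
      (integral_mollify hk) (ae_tendsto_mollify hk)
  have hp := hh.pos_part
  have hn := hh.neg_part
  have hsum := (main hp fun x => le_max_right _ _).add (main hn fun x => le_max_right _ _)
  rw [add_zero] at hsum
  refine squeeze_zero (fun n => integral_nonneg fun x => abs_nonneg _) (fun n => ?_) hsum
  have hpi : Integrable (fun x => |mollify n (fun y => max (h y) 0) x - max (h x) 0|) :=
    ((integrable_mollify hp n).sub hp).abs
  have hni : Integrable (fun x => |mollify n (fun y => max (-h y) 0) x - max (-h x) 0|) :=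
    ((integrable_mollify hn n).sub hn).abs
  rw [← integral_add hpi hni]
  refine integral_mono ((integrable_mollify hh n).sub hh).abs (hpi.add hni) fun x => ?_
  have e : h = fun y => max (h y) 0 - max (-h y) 0 := by
    funext y
    rcases le_total (h y) 0 with hy | hy
    · rw [max_eq_right hy, max_eq_left (by linarith)]; ring
    · rw [max_eq_left hy, max_eq_right (by linarith)]; ring
  have e1 : mollify n h x = mollify n (fun y => max (h y) 0) x - mollify n (fun y => max (-h y) 0) x := by
    conv_lhs => rw [e]
    exact mollify_sub hp hn n x
  have e2 : h x = max (h x) 0 - max (-h x) 0 := congrFun e x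
  simp only
  rw [e1]
  conv_lhs => rw [e2]
  calc _ = |(mollify n (fun y => max (h y) 0) x - max (h x) 0)
        - (mollify n (fun y => max (-h y) 0) x - max (-h x) 0)| := by congr 1; ring
    _ ≤ _ := abs_sub _ _

lemma contDiff_mollify (hh : Integrable h) (n : ℕ) : ContDiff ℝ 1 (mollify n h) :=
  HasCompactSupport.contDiff_convolution_left (n := 1) _ (mollifier d n).hasCompactSupport_normed
    (mollifier d n).contDiff_normed hh.locallyIntegrable

lemma fderiv_mollify_apply (hh : Integrable h) (n : ℕ) (x e : Euc d) :
    fderiv ℝ (mollify n h) x e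
      = ∫ t, fderiv ℝ ((mollifier d n).normed volume) (x - t) e * h t := by
  have hd := HasCompactSupport.hasFDerivAt_convolution_left (μ := volume)
    (f := (mollifier d n).normed volume) (ContinuousLinearMap.lsmul ℝ ℝ)
    (mollifier d n).hasCompactSupport_normed (mollifier d n).contDiff_normed hh.locallyIntegrable x
  rw [show fderiv ℝ (mollify n h) x = _ from hd.fderiv]
  have hex : ConvolutionExistsAt (fderiv ℝ ((mollifier d n).normed volume)) h x
      ((ContinuousLinearMap.lsmul ℝ ℝ).precompL (Euc d)) volume :=
    HasCompactSupport.convolutionExists_left _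
      ((mollifier d n).hasCompactSupport_normed (μ := volume) |>.fderiv (𝕜 := ℝ))
      (((mollifier d n).contDiff_normed (n := 1) (μ := volume)).continuous_fderiv (by simp))
      hh.locallyIntegrable x
  rw [convolution_def, ContinuousLinearMap.integral_apply hex, ← integral_sub_left_eq_self _ _ x]
  simp [ContinuousLinearMap.precompL_apply]

end Mollify

/-! ### Chain rule for weak derivatives -/

/-- The partial derivative in a weak sense commutes with mollification. -/
lemma fderiv_mollify_eq_mollify {d : ℕ} {Λ : Set (Euc d)} (hΛ : MeasurableSet Λ)
    {u γ : Euc d → ℝ} (hu : IntegrableOn u Λ) {e : Euc d}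
    (hw : ∀ φ, IsTest Λ φ → ∫ x in Λ, u x * fderiv ℝ φ x e = -∫ x in Λ, φ x * γ x) {n : ℕ}
    {x : Euc d} (hx : Metric.closedBall x (mollifier d n).rOut ⊆ Λ) :
    fderiv ℝ (mollify n (Λ.indicator u)) x e = mollify n (Λ.indicator γ) x := by
  set ρ := (mollifier d n).normed (volume : Measure (Euc d)) with hρ
  have hρ1 : ContDiff ℝ (⊤ : ℕ∞) ρ := (mollifier d n).contDiff_normed
  -- The reflected kernel is the test function. Its derivative in `y` has the opposite sign, which
  -- cancels the minus sign in the weak formulation.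
  have htest : IsTest Λ (fun y => ρ (x - y)) := by
    have hs : tsupport (fun y => ρ (x - y)) ⊆ Metric.closedBall x (mollifier d n).rOut := by
      refine closure_minimal (fun y hy => ?_) Metric.isClosed_closedBall
      have : x - y ∈ tsupport ρ := subset_tsupport _ hy
      rw [hρ, ContDiffBump.tsupport_normed_eq] at this
      simpa [dist_eq_norm, norm_sub_rev] using this
    exact ⟨hρ1.comp (contDiff_const.sub contDiff_id),
      HasCompactSupport.of_support_subset_isCompact (isCompact_closedBall x _)
        ((subset_tsupport _).trans hs), hs.trans hx⟩
  have h1 := hw _ htest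
  have hder : ∀ y, fderiv ℝ (fun y => ρ (x - y)) y e = -fderiv ℝ ρ (x - y) e := by
    intro y
    have hd : HasFDerivAt ρ (fderiv ℝ ρ (x - y)) (x - y) :=
      (hρ1.differentiable (by simp) _).hasFDerivAt
    have := hd.comp y ((hasFDerivAt_const x y).sub (hasFDerivAt_id y))
    rw [show fderiv ℝ (fun y => ρ (x - y)) y = _ from this.fderiv]
    simp
  rw [fderiv_mollify_apply (hu.integrable_indicator hΛ)]
  have e1 : ∫ t, fderiv ℝ ρ (x - t) e * Λ.indicator u t = ∫ t in Λ, fderiv ℝ ρ (x - t) e * u t := by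
    rw [← integral_indicator hΛ]
    congr 1; funext t; by_cases ht : t ∈ Λ <;> simp [ht]
  have e2 : mollify n (Λ.indicator γ) x = ∫ t in Λ, ρ (x - t) * γ t := by
    rw [mollify, convolution_def, ← integral_sub_left_eq_self _ _ x, ← integral_indicator hΛ]
    congr 1; funext t; by_cases ht : t ∈ Λ <;> simp [ht, hρ]
  rw [e1, e2]
  simp_rw [hder] at h1
  rw [← neg_inj, ← h1, ← integral_neg]
  congr 1; funext t; ring

open Filter Topology in
/-- The chain rule for weak derivatives, tested with a continuously differentiable function. -/
lemma integral_comp_mul_fderiv {d : ℕ} {Λ : Set (Euc d)} (hΛ : IsOpen Λ)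
    {u γ : Euc d → ℝ} (hu : IntegrableOn u Λ) (hγ : IntegrableOn γ Λ) {e : Euc d}
    (hw : ∀ φ, IsTest Λ φ → ∫ x in Λ, u x * fderiv ℝ φ x e = -∫ x in Λ, φ x * γ x)
    {f : ℝ → ℝ} (hf : ContDiff ℝ 1 f) {M : ℝ} (hM : ∀ x, |deriv f x| ≤ M)
    {ψ : Euc d → ℝ} (hψ : ContDiff ℝ 1 ψ) (hψc : HasCompactSupport ψ) (hψs : tsupport ψ ⊆ Λ) :
    ∫ x in Λ, f (u x) * fderiv ℝ ψ x e = -∫ x in Λ, deriv f (u x) * γ x * ψ x := by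
  have hM0 : 0 ≤ M := (abs_nonneg _).trans (hM 0)
  have hlip : ∀ x y, |f x - f y| ≤ M * |x - y| := fun x y => by
    have := Convex.norm_image_sub_le_of_norm_deriv_le (f := f) (s := univ)
      (fun z _ => hf.differentiable one_ne_zero z) (fun z _ => hM z) convex_univ
      (mem_univ y) (mem_univ x)
    simpa using this
  set U := Λ.indicator u with hU
  set Γ := Λ.indicator γ with hΓ
  have hUi : Integrable U := hu.integrable_indicator hΛ.measurableSet
  have hΓi : Integrable Γ := hγ.integrable_indicator hΛ.measurableSet
  have hfd : Continuous (deriv f) := hf.continuous_deriv le_rfl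
  have hψd : Continuous (fun x => fderiv ℝ ψ x e) :=
    (hψ.continuous_fderiv one_ne_zero).clm_apply continuous_const
  have hψdc : HasCompactSupport (fun x => fderiv ℝ ψ x e) :=
    (hψc.fderiv (𝕜 := ℝ)).comp_left (g := fun L : Euc d →L[ℝ] ℝ => L e) (by simp)
  obtain ⟨A, hA⟩ := hψd.bounded_above_of_compact_support hψdc
  obtain ⟨B, hB⟩ := hψ.continuous.bounded_above_of_compact_support hψc
  have hψi : Integrable ψ := hψ.continuous.integrable_of_hasCompactSupport hψc
  have hψdi : Integrable (fun x => fderiv ℝ ψ x e) := hψd.integrable_of_hasCompactSupport hψdc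
  have hz : ∀ x, x ∉ Λ → ψ x = 0 := fun x hx => image_eq_zero_of_notMem_tsupport fun h => hx (hψs h)
  have hzd : ∀ x, x ∉ Λ → fderiv ℝ ψ x e = 0 := fun x hx => by
    have : fderiv ℝ ψ x = 0 := by
      by_contra h
      exact hx (hψs (tsupport_fderiv_subset ℝ (subset_tsupport _ h)))
    simp [this]
  have eL : ∫ x in Λ, f (u x) * fderiv ℝ ψ x e = ∫ x, f (U x) * fderiv ℝ ψ x e := by
    rw [← integral_indicator hΛ.measurableSet]
    congr 1; funext x; by_cases hx : x ∈ Λ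
    · simp [hx, hU]
    · simp [hx, hzd x hx]
  have eR : ∫ x in Λ, deriv f (u x) * γ x * ψ x = ∫ x, deriv f (U x) * Γ x * ψ x := by
    rw [← integral_indicator hΛ.measurableSet]
    congr 1; funext x; by_cases hx : x ∈ Λ
    · simp [hx, hU, hΓ]
    · simp [hx, hz x hx]
  rw [eL, eR]
  -- Kernels of radius below `δ` centred on the support of `ψ` stay inside `Λ`, so they do not see
  -- the jump created by extending `u` by zero.
  obtain ⟨δ, hδ, hδΛ⟩ := hψc.isCompact.exists_cthickening_subset_open hΛ hψs
  have hcont : ∀ n, Continuous (mollify n U) := fun n => (contDiff_mollify hUi n).continuous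
  have hfU : AEStronglyMeasurable (fun x => f (U x)) volume :=
    hf.continuous.comp_aestronglyMeasurable hUi.aestronglyMeasurable
  have hfdU : AEStronglyMeasurable (fun x => deriv f (U x)) volume :=
    hfd.comp_aestronglyMeasurable hUi.aestronglyMeasurable
  have hfUi : Integrable (fun x => f (U x) * fderiv ℝ ψ x e) := by
    have h1 : Integrable (fun x => (f (U x) - f 0) * fderiv ℝ ψ x e) := by
      refine Integrable.mul_bdd (c := A) ?_ hψd.aestronglyMeasurable (Eventually.of_forall hA)
      refine (hUi.abs.const_mul M).mono' (hfU.sub aestronglyMeasurable_const)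
        (Eventually.of_forall fun x => ?_)
      simpa using hlip (U x) 0
    refine (h1.add (hψdi.const_mul (f 0))).congr (Eventually.of_forall fun x => ?_)
    simp only [Pi.add_apply]; ring
  -- the identity for the mollifications
  have hstep : ∀ᶠ n in atTop, ∫ x, f (mollify n U x) * fderiv ℝ ψ x e
      = -∫ x, deriv f (mollify n U x) * mollify n Γ x * ψ x := by
    filter_upwards [(tendsto_mollifier_rOut (d := d)).eventually (gt_mem_nhds hδ)] with n hn
    have hd := contDiff_mollify hUi n
    have hF : ContDiff ℝ 1 (fun x => f (mollify n U x)) := hf.comp hd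
    have hFd : Continuous (fun x => fderiv ℝ (fun x => f (mollify n U x)) x e) :=
      (hF.continuous_fderiv one_ne_zero).clm_apply continuous_const
    rw [integral_mul_fderiv_eq_neg_fderiv_mul_of_integrable
      ((hFd.mul hψ.continuous).integrable_of_hasCompactSupport hψc.mul_left)
      ((hF.continuous.mul hψd).integrable_of_hasCompactSupport hψdc.mul_left)
      ((hF.continuous.mul hψ.continuous).integrable_of_hasCompactSupport hψc.mul_left)
      (fun x _ => hF.differentiable one_ne_zero x) (fun x _ => hψ.differentiable one_ne_zero x)]
    congr 1
    refine integral_congr_ae (Eventually.of_forall fun x => ?_)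
    by_cases hx : x ∈ tsupport ψ
    · have hball : Metric.closedBall x (mollifier d n).rOut ⊆ Λ :=
        (Metric.closedBall_subset_cthickening hx _).trans
          ((Metric.cthickening_mono hn.le _).trans hδΛ)
      have hc : HasFDerivAt (fun x => f (mollify n U x))
          (deriv f (mollify n U x) • fderiv ℝ (mollify n U) x) x :=
        (hf.differentiable one_ne_zero _).hasDerivAt.comp_hasFDerivAt x
          (hd.differentiable one_ne_zero x).hasFDerivAt
      simp only
      rw [hc.fderiv, _root_.smul_apply, smul_eq_mul,
        fderiv_mollify_eq_mollify hΛ.measurableSet hu hw hball]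
    · simp [image_eq_zero_of_notMem_tsupport hx]
  -- `f` may be unbounded, but it is Lipschitz, so `L¹` convergence of the mollifications is enough.
  have hlimL : Tendsto (fun n => ∫ x, f (mollify n U x) * fderiv ℝ ψ x e) atTop
      (𝓝 (∫ x, f (U x) * fderiv ℝ ψ x e)) := by
    rw [tendsto_iff_norm_sub_tendsto_zero]
    have hb := (tendsto_integral_abs_mollify_sub hUi).const_mul (M * A)
    rw [mul_zero] at hb
    refine squeeze_zero (fun n => norm_nonneg _) (fun n => ?_) hb
    have hi : Integrable (fun x => f (mollify n U x) * fderiv ℝ ψ x e) :=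
      ((hf.continuous.comp (hcont n)).mul hψd).integrable_of_hasCompactSupport hψdc.mul_left
    rw [← integral_sub hi hfUi, ← integral_const_mul]
    refine norm_integral_le_of_norm_le
      (((integrable_mollify hUi n).sub hUi).abs.const_mul _) (Eventually.of_forall fun x => ?_)
    rw [← sub_mul, norm_mul]
    calc _ ≤ (M * |mollify n U x - U x|) * A := by
          gcongr
          · exact hlip _ _
          · exact hA x
      _ = _ := by ring
  have hB0 : 0 ≤ B := (norm_nonneg _).trans (hB 0)
  have hΓψ : Integrable (fun x => Γ x * ψ x) :=
    hΓi.mul_bdd (c := B) hψ.continuous.aestronglyMeasurable (Eventually.of_forall hB)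
  have hgi : ∀ {w : Euc d → ℝ}, AEStronglyMeasurable w volume →
      Integrable (fun x => deriv f (w x) * (Γ x * ψ x)) := fun {w} hw' =>
    hΓψ.bdd_mul (c := M) (hfd.comp_aestronglyMeasurable hw') (Eventually.of_forall fun x => hM _)
  -- The right-hand side is split: `f'(Uₙ) Γ ψ` converges by domination, `f'` being bounded and
  -- continuous, and `f'(Uₙ)(Γₙ - Γ) ψ` tends to zero because `Γₙ → Γ` in `L¹`.
  have hlim1 : Tendsto (fun n => ∫ x, deriv f (mollify n U x) * (Γ x * ψ x)) atTop
      (𝓝 (∫ x, deriv f (U x) * (Γ x * ψ x))) := by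
    refine tendsto_integral_of_dominated_convergence (fun x => M * |Γ x * ψ x|)
      (fun n => (hgi (hcont n).aestronglyMeasurable).aestronglyMeasurable)
      (hΓψ.abs.const_mul M) (fun n => Eventually.of_forall fun x => ?_) ?_
    · rw [norm_mul]
      exact mul_le_mul_of_nonneg_right (hM _) (abs_nonneg _)
    · filter_upwards [ae_tendsto_mollify hUi] with x hx
      exact ((hfd.tendsto _).comp hx).mul tendsto_const_nhds
  have hlim2 : Tendsto (fun n => ∫ x, deriv f (mollify n U x) * (mollify n Γ x - Γ x) * ψ x) atTop
      (𝓝 0) := by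
    rw [tendsto_zero_iff_norm_tendsto_zero]
    have hb := (tendsto_integral_abs_mollify_sub hΓi).const_mul (M * B)
    rw [mul_zero] at hb
    refine squeeze_zero (fun n => norm_nonneg _) (fun n => ?_) hb
    rw [← integral_const_mul]
    refine norm_integral_le_of_norm_le
      (((integrable_mollify hΓi n).sub hΓi).abs.const_mul _) (Eventually.of_forall fun x => ?_)
    rw [norm_mul, norm_mul]
    calc _ ≤ (M * |mollify n Γ x - Γ x|) * B := by
          gcongr
          · exact hM _
          · exact le_rfl
          · exact hB x
      _ = _ := by ring
  have hlimR : Tendsto (fun n => ∫ x, deriv f (mollify n U x) * mollify n Γ x * ψ x) atTop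
      (𝓝 (∫ x, deriv f (U x) * Γ x * ψ x)) := by
    have := hlim1.add hlim2
    simp_rw [add_zero, ← mul_assoc] at this
    refine this.congr fun n => ?_
    have i1 := hgi (hcont n).aestronglyMeasurable
    have i2 : Integrable (fun x => deriv f (mollify n U x) * (mollify n Γ x - Γ x) * ψ x) :=
      (((integrable_mollify hΓi n).sub hΓi).bdd_mul (c := M)
        (hfd.comp (hcont n)).aestronglyMeasurable (Eventually.of_forall fun x => hM _)).mul_bdd (c := B)
        hψ.continuous.aestronglyMeasurable (Eventually.of_forall hB)
    simp_rw [← mul_assoc] at i1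
    rw [← integral_add i1 i2]
    congr 1; funext x; ring
  exact tendsto_nhds_unique hlimL ((tendsto_congr' hstep).2 hlimR.neg)


/-! ### Calculus in `H¹` -/

lemma IsC2Bounded.contDiff_one {g : ℝ → ℝ} (hg : IsC2Bounded g) : ContDiff ℝ 1 g :=
  hg.1.of_le (by norm_num)

lemma real_inner_eq_mul (a b : ℝ) : inner ℝ a b = a * b := by simp [mul_comm]

section Calculus

variable {d : ℕ} {Λ : Set (Euc d)}

lemma abs_sub_le_of_abs_deriv_le {g : ℝ → ℝ} (hg : ContDiff ℝ 1 g) {M : ℝ}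
    (hM : ∀ x, |deriv g x| ≤ M) (x y : ℝ) : |g x - g y| ≤ M * |x - y| := by
  have := Convex.norm_image_sub_le_of_norm_deriv_le (f := g) (s := univ)
    (fun z _ => hg.differentiable one_ne_zero z) (fun z _ => hM z) convex_univ
    (mem_univ y) (mem_univ x)
  simpa using this

/-- The product of a bounded function with an element of `L²(Λ)`. -/
lemma exists_smul_L2 {F : Type} [NormedAddCommGroup F] [NormedSpace ℝ F] {a : Euc d → ℝ} {L : ℝ}
    (ha : AEStronglyMeasurable a (volume.restrict Λ)) (hL : ∀ x, |a x| ≤ L) (G : L2 Λ F) :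
    ∃ K : L2 Λ F, K =ᵐ[volume.restrict Λ] (fun x => a x • G x) ∧ ‖K‖ ≤ L * ‖G‖ := by
  have hb : ∀ x, ‖a x • G x‖ ≤ L * ‖G x‖ := fun x => by
    rw [norm_smul]; exact mul_le_mul_of_nonneg_right (hL x) (norm_nonneg _)
  have hm : MemLp (fun x => a x • G x) 2 (volume.restrict Λ) :=
    (Lp.memLp G).of_le_mul (ha.smul (Lp.aestronglyMeasurable G)) (Filter.Eventually.of_forall hb)
  refine ⟨hm.toLp _, hm.coeFn_toLp, Lp.norm_le_mul_norm_of_ae_le_mul ?_⟩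
  filter_upwards [hm.coeFn_toLp] with x hx
  rw [hx]; exact hb x

/-- The constant function `1` in `L²(Λ)`. -/
def oneL2 (Λ : Set (Euc d)) [IsFiniteMeasure (volume.restrict Λ)] : L2 Λ ℝ :=
  (memLp_const (1 : ℝ)).toLp (fun _ => 1)

lemma coeFn_oneL2 [IsFiniteMeasure (volume.restrict Λ)] :
    oneL2 Λ =ᵐ[volume.restrict Λ] fun _ => (1 : ℝ) :=
  MemLp.coeFn_toLp _

/-- The composition of a Lipschitz function with an element of `L²(Λ)`. -/
lemma exists_comp_L2 [IsFiniteMeasure (volume.restrict Λ)] {g : ℝ → ℝ} (hg : ContDiff ℝ 1 g)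
    {L : ℝ} (hL : ∀ x, |deriv g x| ≤ L) (u : L2 Λ ℝ) :
    ∃ K : L2 Λ ℝ, K =ᵐ[volume.restrict Λ] (fun x => g (u x)) ∧
      ‖K‖ ≤ |g 0| * ‖oneL2 Λ‖ + L * ‖u‖ := by
  have hb : ∀ x, ‖g (u x) - g 0‖ ≤ L * ‖u x‖ := fun x => by
    simpa using abs_sub_le_of_abs_deriv_le hg hL (u x) 0
  have hm : MemLp (fun x => g (u x) - g 0) 2 (volume.restrict Λ) :=
    (Lp.memLp u).of_le_mul
      ((hg.continuous.comp_aestronglyMeasurable (Lp.aestronglyMeasurable u)).sub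
        aestronglyMeasurable_const) (Filter.Eventually.of_forall hb)
  refine ⟨g 0 • oneL2 Λ + hm.toLp _, ?_, (norm_add_le _ _).trans ?_⟩
  · filter_upwards [Lp.coeFn_add (g 0 • oneL2 Λ) (hm.toLp _), Lp.coeFn_smul (g 0) (oneL2 Λ),
      hm.coeFn_toLp, coeFn_oneL2 (Λ := Λ)] with x h1 h2 h3 h4
    rw [h1, Pi.add_apply, h2, Pi.smul_apply, h3, h4]
    simp
  · rw [norm_smul, Real.norm_eq_abs]
    gcongr
    refine Lp.norm_le_mul_norm_of_ae_le_mul ?_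
    filter_upwards [hm.coeFn_toLp] with x hx
    rw [hx]; exact hb x

lemma IsTest.integrable_of_memLp {φ : Euc d → ℝ} (hφ : IsTest Λ φ) {F : Type}
    [NormedAddCommGroup F] [NormedSpace ℝ F] {G : Euc d → F} (hG : MemLp G 2 (volume.restrict Λ)) :
    Integrable (fun x => φ x • G x) (volume.restrict Λ) :=
  memLp_one_iff_integrable.1 (hG.smul hφ.memLp)

lemma inner_smul_gradient (c : ℝ) (φ : Euc d → ℝ) (x e : Euc d) :
    inner ℝ e (c • gradient φ x) = c * fderiv ℝ φ x e := by
  rw [inner_smul_right, real_inner_comm, inner_gradient_left]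

/-- The directional form of the definition of the weak gradient. -/
lemma IsWeakGradient.integral_mul_fderiv {u : L2 Λ ℝ} {G : L2 Λ (Euc d)}
    (h : IsWeakGradient Λ u G) (e : Euc d) {φ : Euc d → ℝ} (hφ : IsTest Λ φ) :
    ∫ x in Λ, u x * fderiv ℝ φ x e = -∫ x in Λ, φ x * inner ℝ e (G x) := by
  have h1 := congrArg (fun z => inner ℝ e z) (h φ hφ)
  simp only [inner_neg_right] at h1
  rw [← integral_inner (hφ.integrable_smul_gradient u), ← integral_inner (hφ.integrable_smul G)]
    at h1
  simp only [inner_smul_gradient] at h1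
  simpa only [inner_smul_right] using h1

lemma integrable_L2 [IsFiniteMeasure (volume.restrict Λ)] {F : Type} [NormedAddCommGroup F]
    (u : L2 Λ F) : Integrable u (volume.restrict Λ) :=
  (Lp.memLp u).integrable (by norm_num)

/-- The chain rule in `H¹(Λ)`, tested with a continuously differentiable function. -/
lemma H1.integral_comp_mul_fderiv [IsFiniteMeasure (volume.restrict Λ)] (hΛ : IsOpen Λ)
    {g : ℝ → ℝ} (hg : ContDiff ℝ 1 g) {L : ℝ} (hL : ∀ x, |deriv g x| ≤ L) (u : H1 Λ) (e : Euc d)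
    {ψ : Euc d → ℝ} (hψ : ContDiff ℝ 1 ψ) (hψc : HasCompactSupport ψ) (hψs : tsupport ψ ⊆ Λ) :
    ∫ x in Λ, g (H1fn u x) * fderiv ℝ ψ x e
      = -∫ x in Λ, deriv g (H1fn u x) * inner ℝ e (H1grad u x) * ψ x := by
  have hu : IsWeakGradient Λ (H1fn u) (H1grad u) := u.2
  exact _root_.integral_comp_mul_fderiv hΛ (integrable_L2 (H1fn u))
    ((integrable_L2 (H1grad u)).const_inner e) (fun φ hφ => hu.integral_mul_fderiv e hφ)
    hg hL hψ hψc hψs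

/-- The composition of a `C¹` function with bounded derivative with an element of `H¹(Λ)`. -/
lemma H1.exists_comp [IsFiniteMeasure (volume.restrict Λ)] (hΛ : IsOpen Λ)
    {g : ℝ → ℝ} (hg : ContDiff ℝ 1 g) {L : ℝ} (hL : ∀ x, |deriv g x| ≤ L) (u : H1 Λ) :
    ∃ w : H1 Λ, H1fn w =ᵐ[volume.restrict Λ] (fun x => g (H1fn u x)) ∧
      H1grad w =ᵐ[volume.restrict Λ] (fun x => deriv g (H1fn u x) • H1grad u x) ∧
      ‖H1fn w‖ ≤ |g 0| * ‖oneL2 Λ‖ + L * ‖H1fn u‖ ∧ ‖H1grad w‖ ≤ L * ‖H1grad u‖ := by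
  obtain ⟨a, ha, han⟩ := exists_comp_L2 hg hL (H1fn u)
  obtain ⟨b, hb, hbn⟩ := exists_smul_L2 (Λ := Λ) (a := fun x => deriv g (H1fn u x))
    ((hg.continuous_deriv le_rfl).comp_aestronglyMeasurable (Lp.aestronglyMeasurable (H1fn u)))
    (fun x => hL _) (H1grad u)
  have hw : IsWeakGradient Λ a b := by
    intro φ hφ
    refine ext_inner_left ℝ fun e => ?_
    rw [inner_neg_right, ← integral_inner (hφ.integrable_smul_gradient a),
      ← integral_inner (hφ.integrable_smul b)]
    simp only [inner_smul_gradient]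
    have h1 := H1.integral_comp_mul_fderiv hΛ hg hL u e (hφ.1.of_le (by exact_mod_cast le_top))
      hφ.2.1 hφ.2.2
    rw [integral_congr_ae (g := fun x => g (H1fn u x) * fderiv ℝ φ x e), h1]
    · congr 1
      refine integral_congr_ae ?_
      filter_upwards [hb] with x hx
      rw [hx, inner_smul_right, inner_smul_right]
      ring
    · filter_upwards [ha] with x hx
      rw [hx]
  exact ⟨⟨WithLp.toLp 2 (a, b), hw⟩, ha, hb, han, hbn⟩

lemma H1.norm_sq (u : H1 Λ) : ‖u‖ ^ 2 = ‖H1fn u‖ ^ 2 + ‖H1grad u‖ ^ 2 :=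
  WithLp.prod_norm_sq_eq_of_L2 u.1

lemma H1.inner_eq (u w : H1 Λ) :
    inner ℝ u w = inner ℝ (H1fn u) (H1fn w) + inner ℝ (H1grad u) (H1grad w) :=
  WithLp.prod_inner_apply u.1 w.1

lemma H1.norm_fn_le (u : H1 Λ) : ‖H1fn u‖ ≤ ‖u‖ :=
  le_of_sq_le_sq (by rw [H1.norm_sq]; linarith [sq_nonneg ‖H1grad u‖]) (norm_nonneg _)

lemma H1.norm_grad_le (u : H1 Λ) : ‖H1grad u‖ ≤ ‖u‖ :=
  le_of_sq_le_sq (by rw [H1.norm_sq]; linarith [sq_nonneg ‖H1fn u‖]) (norm_nonneg _)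

lemma H1.norm_le (u : H1 Λ) : ‖u‖ ≤ ‖H1fn u‖ + ‖H1grad u‖ :=
  le_of_sq_le_sq (by
    rw [H1.norm_sq]
    nlinarith [mul_nonneg (norm_nonneg (H1fn u)) (norm_nonneg (H1grad u))]) (by positivity)

lemma continuous_H1fn : Continuous (H1fn : H1 Λ → L2 Λ ℝ) :=
  (WithLp.prod_continuous_ofLp 2 _ _).fst.comp continuous_subtype_val

lemma continuous_H1grad : Continuous (H1grad : H1 Λ → L2 Λ (Euc d)) :=
  (WithLp.prod_continuous_ofLp 2 _ _).snd.comp continuous_subtype_val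

/-! ### The transport term -/

/-- The weak divergence of `f(u) b` for a divergence free field `b`. -/
lemma norm_weakDivergence_le [IsFiniteMeasure (volume.restrict Λ)] (hΛ : IsOpen Λ)
    {f : ℝ → ℝ} (hf : ContDiff ℝ 1 f) {L : ℝ} (hL : ∀ x, |deriv f x| ≤ L)
    {b : Euc d → Euc d} (hb : ContDiffOn ℝ 1 b Λ) {M : ℝ} (hM : ∀ x ∈ Λ, ‖b x‖ ≤ M)
    (hdiv : ∀ x ∈ Λ, divergence b x = 0) {u : H1 Λ} {D : L2 Λ ℝ}
    (hD : IsWeakDivergence Λ (fun x => f (H1fn u x) • b x) D) :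
    ‖D‖ ≤ L * M * ‖H1grad u‖ := by
  have hL0 : 0 ≤ L := (abs_nonneg _).trans (hL 0)
  have hbm : AEStronglyMeasurable b (volume.restrict Λ) :=
    hb.continuousOn.aestronglyMeasurable hΛ.measurableSet
  have hbound : ∀ x ∈ Λ, ‖deriv f (H1fn u x) * inner ℝ (b x) (H1grad u x)‖
      ≤ L * M * ‖H1grad u x‖ := fun x hx => by
    rw [norm_mul, mul_assoc]
    exact mul_le_mul (hL _) ((norm_inner_le_norm _ _).trans
      (mul_le_mul_of_nonneg_right (hM x hx) (norm_nonneg _))) (norm_nonneg _) hL0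
  have hm : MemLp (fun x => deriv f (H1fn u x) * inner ℝ (b x) (H1grad u x)) 2
      (volume.restrict Λ) := by
    refine (Lp.memLp (H1grad u)).of_le_mul (c := L * M)
      (((hf.continuous_deriv le_rfl).comp_aestronglyMeasurable
        (Lp.aestronglyMeasurable (H1fn u))).mul
        (hbm.inner (Lp.aestronglyMeasurable (H1grad u)))) ?_
    exact (ae_restrict_iff' hΛ.measurableSet).2 (Filter.Eventually.of_forall hbound)
  -- This identifies `D` with `f'(u) b·∇u`. The chain rule is tested in direction `i` with `bᵢ φ`,
  -- which is only `C¹`, and summed: `∑ ∂ᵢ(bᵢ φ) = b·∇φ` because `div b = 0`.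
  have hint : ∀ φ, IsTest Λ φ → ∫ x in Λ, φ x * D x
      = ∫ x in Λ, φ x * (deriv f (H1fn u x) * inner ℝ (b x) (H1grad u x)) := by
    intro φ hφ
    have hφ1 : ContDiff ℝ 1 φ := hφ.1.of_le (by exact_mod_cast le_top)
    have hψs : ∀ i, tsupport (fun x => b x i * φ x) ⊆ tsupport φ := fun i =>
      closure_mono fun x hx => right_ne_zero_of_mul hx
    have hbat : ∀ x ∈ Λ, ∀ i, ContDiffAt ℝ 1 (fun x => b x i) x := fun x hx i =>
      (contDiffAt_euclidean.1 (hb.contDiffAt (hΛ.mem_nhds hx))) i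
    -- `b` is regular only in `Λ`; away from the support of `φ` the product vanishes locally.
    have hψ : ∀ i, ContDiff ℝ 1 (fun x => b x i * φ x) := fun i =>
      contDiff_iff_contDiffAt.2 fun x => by
        by_cases hx : x ∈ tsupport φ
        · exact (hbat x (hφ.2.2 hx) i).mul hφ1.contDiffAt
        · refine (contDiffAt_const (c := (0 : ℝ))).congr_of_eventuallyEq ?_
          filter_upwards [notMem_tsupport_iff_eventuallyEq.1 hx] with y hy
          simp [hy]
    have hψc : ∀ i, HasCompactSupport (fun x => b x i * φ x) := fun i => hφ.2.1.mul_left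
    have hfi : ∀ i, Integrable
        (fun x => f (H1fn u x) * fderiv ℝ (fun x => b x i * φ x) x (EuclideanSpace.single i 1))
        (volume.restrict Λ) := by
      intro i
      obtain ⟨K, hK, -⟩ := exists_comp_L2 hf hL (H1fn u)
      have hcd : Continuous
          (fun x => fderiv ℝ (fun x => b x i * φ x) x (EuclideanSpace.single i (1 : ℝ))) :=
        ((hψ i).continuous_fderiv one_ne_zero).clm_apply continuous_const
      obtain ⟨A, hA⟩ := hcd.bounded_above_of_compact_support
        (((hψc i).fderiv (𝕜 := ℝ)).comp_left
          (g := fun T : Euc d →L[ℝ] ℝ => T (EuclideanSpace.single i (1 : ℝ))) (by simp))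
      exact ((integrable_L2 K).congr hK).mul_bdd (c := A) hcd.aestronglyMeasurable
        (Filter.Eventually.of_forall hA)
    have hgi : ∀ i, Integrable (fun x => deriv f (H1fn u x)
        * inner ℝ (EuclideanSpace.single i (1 : ℝ)) (H1grad u x) * (b x i * φ x))
        (volume.restrict Λ) := by
      intro i
      obtain ⟨A, hA⟩ := (hψ i).continuous.bounded_above_of_compact_support (hψc i)
      exact (((integrable_L2 (H1grad u)).const_inner _).bdd_mul (c := L)
        ((hf.continuous_deriv le_rfl).comp_aestronglyMeasurable
          (Lp.aestronglyMeasurable (H1fn u)))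
        (Filter.Eventually.of_forall fun x => hL _)).mul_bdd (c := A)
        (hψ i).continuous.aestronglyMeasurable (Filter.Eventually.of_forall hA)
    have h1 : ∫ x in Λ, inner ℝ (f (H1fn u x) • b x) (gradient φ x)
        = ∑ i, ∫ x in Λ, f (H1fn u x)
          * fderiv ℝ (fun x => b x i * φ x) x (EuclideanSpace.single i 1) := by
      rw [← integral_finsetSum _ fun i _ => hfi i]
      refine setIntegral_congr_fun hΛ.measurableSet fun x hx => ?_
      have hd : ∀ i, fderiv ℝ (fun x => b x i * φ x) x (EuclideanSpace.single i 1)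
          = b x i * fderiv ℝ φ x (EuclideanSpace.single i 1)
            + φ x * fderiv ℝ b x (EuclideanSpace.single i 1) i := by
        intro i
        have hbx : DifferentiableAt ℝ b x := (hb.contDiffAt (hΛ.mem_nhds hx)).differentiableAt
          one_ne_zero
        have hb' : HasFDerivAt (fun x => b x i) ((EuclideanSpace.proj i : Euc d →L[ℝ] ℝ).comp
            (fderiv ℝ b x)) x :=
          (EuclideanSpace.proj i : Euc d →L[ℝ] ℝ).hasFDerivAt.comp x hbx.hasFDerivAt
        have hp : fderiv ℝ (fun x => b x i * φ x) x = _ :=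
          (hb'.mul (hφ1.differentiable one_ne_zero x).hasFDerivAt).fderiv
        rw [hp]
        simp
      have hdv := hdiv x hx
      rw [divergence] at hdv
      simp only [hd]
      rw [← Finset.mul_sum, Finset.sum_add_distrib, ← Finset.mul_sum, hdv, mul_zero, add_zero,
        inner_smul_left, real_inner_comm, inner_gradient_left]
      congr 1
      conv_lhs => rw [← (EuclideanSpace.basisFun (Fin d) ℝ).sum_repr (b x)]
      simp
    have h2 : ∫ x in Λ, φ x * (deriv f (H1fn u x) * inner ℝ (b x) (H1grad u x))
        = ∑ i, ∫ x in Λ, deriv f (H1fn u x)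
          * inner ℝ (EuclideanSpace.single i (1 : ℝ)) (H1grad u x) * (b x i * φ x) := by
      rw [← integral_finsetSum _ fun i _ => hgi i]
      refine integral_congr_ae (Filter.Eventually.of_forall fun x => ?_)
      have : inner ℝ (b x) (H1grad u x)
          = ∑ i, b x i * inner ℝ (EuclideanSpace.single i (1 : ℝ)) (H1grad u x) := by
        rw [PiLp.inner_apply]
        refine Finset.sum_congr rfl fun i _ => ?_
        rw [EuclideanSpace.inner_single_left]
        simp [mul_comm]
      simp only
      rw [this, Finset.mul_sum, Finset.mul_sum]
      exact Finset.sum_congr rfl fun i _ => by ring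
    have h3 := hD φ hφ
    rw [h1] at h3
    simp_rw [H1.integral_comp_mul_fderiv hΛ hf hL u _ (hψ _) (hψc _) ((hψs _).trans hφ.2.2)] at h3
    rw [Finset.sum_neg_distrib, ← h2, neg_inj] at h3
    rw [h3]
    simp_rw [mul_comm]
  have hae : ∀ᵐ x, x ∈ Λ → D x - deriv f (H1fn u x) * inner ℝ (b x) (H1grad u x) = 0 := by
    refine hΛ.ae_eq_zero_of_integral_contDiff_smul_eq_zero
      (IntegrableOn.locallyIntegrableOn ((integrable_L2 D).sub (hm.integrable (by norm_num))))
      fun φ h1 h2 h3 => ?_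
    have hφ : IsTest Λ φ := ⟨h1, h2, h3⟩
    rw [← setIntegral_eq_integral_of_forall_compl_eq_zero (s := Λ) (fun x hx => by
      rw [image_eq_zero_of_notMem_tsupport fun h => hx (h3 h), zero_smul])]
    have := hint φ hφ
    simp only [smul_eq_mul, mul_sub]
    exact (integral_sub (hφ.integrable_of_memLp (Lp.memLp D)) (hφ.integrable_of_memLp hm)).trans
      (by simp only [smul_eq_mul]; rw [this, sub_self])
  refine Lp.norm_le_mul_norm_of_ae_le_mul ((ae_restrict_iff' hΛ.measurableSet).2 ?_)
  filter_upwards [hae] with x hx hxΛ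
  rw [sub_eq_zero.1 (hx hxΛ)]
  exact hbound x hxΛ

/-- The quadratic functional `u ↦ ⟨g(u), u⟩` in `H¹(Λ)`. -/
def compPairing (g : ℝ → ℝ) (u : H1 Λ) : ℝ :=
  (∫ x in Λ, g (H1fn u x) * H1fn u x)
    + ∫ x in Λ, deriv g (H1fn u x) * inner ℝ (H1grad u x) (H1grad u x)

/-- The element `w` is obtained separately for each realization and carries no measurability. The
explicit expression depends on `u` alone and continuously, so it is measurable with respect to the
past when `u` is. -/
lemma inner_eq_compPairing {g : ℝ → ℝ} {u w : H1 Λ}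
    (h1 : H1fn w =ᵐ[volume.restrict Λ] (fun x => g (H1fn u x)))
    (h2 : H1grad w =ᵐ[volume.restrict Λ] (fun x => deriv g (H1fn u x) • H1grad u x)) :
    inner ℝ w u = compPairing g u := by
  rw [H1.inner_eq, L2.inner_def, L2.inner_def, compPairing]
  congr 1
  · refine integral_congr_ae ?_
    filter_upwards [h1] with x hx
    rw [hx, real_inner_eq_mul]
  · refine integral_congr_ae ?_
    filter_upwards [h2] with x hx
    rw [hx, inner_smul_left]
    rfl

lemma abs_integral_mul_inner_le {F : Type} [NormedAddCommGroup F] [InnerProductSpace ℝ F]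
    {a : Euc d → ℝ} {L : ℝ} (ha : AEStronglyMeasurable a (volume.restrict Λ))
    (hL : ∀ x, |a x| ≤ L) (G H : L2 Λ F) :
    |∫ x in Λ, a x * inner ℝ (G x) (H x)| ≤ L * ‖G‖ * ‖H‖ := by
  obtain ⟨K, hK, hKn⟩ := exists_smul_L2 ha hL G
  have : ∫ x in Λ, a x * inner ℝ (G x) (H x) = inner ℝ K H := by
    rw [L2.inner_def]
    refine integral_congr_ae ?_
    filter_upwards [hK] with x hx
    rw [hx, real_inner_smul_left]
  rw [this]
  exact (abs_real_inner_le_norm _ _).trans (mul_le_mul_of_nonneg_right hKn (norm_nonneg _))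

open Filter Topology in
-- The zeroth order part is an `L²` product of continuous maps. In the gradient part the coefficient
-- `g'(u)` is only bounded and continuous, so it converges almost everywhere along subsequences;
-- this suffices for dominated convergence.
lemma continuous_compPairing [IsFiniteMeasure (volume.restrict Λ)] {g : ℝ → ℝ}
    (hg : ContDiff ℝ 1 g) {L : ℝ} (hL : ∀ x, |deriv g x| ≤ L) :
    Continuous (compPairing g : H1 Λ → ℝ) := by
  have hL0 : 0 ≤ L := (abs_nonneg _).trans (hL 0)
  have hgd := hg.continuous_deriv le_rfl
  refine Continuous.add ?_ ?_
  · have hlip : LipschitzWith ⟨L, hL0⟩ (fun x => g x - g 0) :=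
      LipschitzWith.of_dist_le_mul fun x y => by
        simpa [Real.dist_eq] using! abs_sub_le_of_abs_deriv_le hg hL x y
    have h0 : (fun x => g x - g 0) 0 = 0 := sub_self _
    have hc : Continuous fun u : H1 Λ => inner ℝ (hlip.compLp h0 (H1fn u)) (H1fn u)
        + g 0 * inner ℝ (oneL2 Λ) (H1fn u) :=
      (((hlip.continuous_compLp h0).comp continuous_H1fn).inner continuous_H1fn).add
        (continuous_const.mul (continuous_const.inner continuous_H1fn))
    convert hc using 2 with u
    rw [← real_inner_smul_left, ← inner_add_left, L2.inner_def]
    refine integral_congr_ae ?_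
    filter_upwards [Lp.coeFn_add (hlip.compLp h0 (H1fn u)) (g 0 • oneL2 Λ),
      Lp.coeFn_smul (g 0) (oneL2 Λ), hlip.coeFn_compLp h0 (H1fn u), coeFn_oneL2 (Λ := Λ)]
      with x h1 h2 h3 h4
    rw [h1, Pi.add_apply, h2, Pi.smul_apply, h3, h4, real_inner_eq_mul]
    simp
  · refine continuous_iff_seqContinuous.2 fun v u hv => ?_
    refine tendsto_of_subseq_tendsto fun ns hns => ?_
    have hv' := hv.comp hns
    have hfn := (continuous_H1fn.tendsto u).comp hv'
    have hgr := (continuous_H1grad.tendsto u).comp hv'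
    obtain ⟨ms, hms, hae⟩ := (tendstoInMeasure_of_tendsto_Lp hfn).exists_seq_tendsto_ae
    refine ⟨ms, ?_⟩
    have hgr' := hgr.comp hms.tendsto_atTop
    set a : ℕ → Euc d → ℝ := fun n x => deriv g (H1fn (v (ns (ms n))) x) with ha
    set G : ℕ → L2 Λ (Euc d) := fun n => H1grad (v (ns (ms n))) with hG
    have ham : ∀ n, AEStronglyMeasurable (a n) (volume.restrict Λ) := fun n =>
      hgd.comp_aestronglyMeasurable (Lp.aestronglyMeasurable _)
    have hi : ∀ n (A B : L2 Λ (Euc d)),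
        Integrable (fun x => a n x * inner ℝ (A x) (B x)) (volume.restrict Λ) := fun n A B =>
      (L2.integrable_inner (𝕜 := ℝ) A B).bdd_mul (c := L) (ham n)
        (Eventually.of_forall fun x => hL _)
    -- `|G|² - |∇u|² = (G - ∇u)·(G + ∇u)`: the first integral has a fixed integrable factor, the
    -- second is small because `G n → ∇u` in `L²`.
    have hsplit : ∀ n, ∫ x in Λ, a n x * inner ℝ (G n x) (G n x)
        = (∫ x in Λ, a n x * inner ℝ (H1grad u x) (H1grad u x))
          + ∫ x in Λ, a n x * inner ℝ ((G n - H1grad u) x) ((G n + H1grad u) x) := by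
      intro n
      rw [← integral_add (hi n _ _) (hi n _ _)]
      refine integral_congr_ae ?_
      filter_upwards [Lp.coeFn_sub (G n) (H1grad u), Lp.coeFn_add (G n) (H1grad u)] with x h1 h2
      rw [h1, h2, Pi.sub_apply, Pi.add_apply, inner_sub_left, inner_add_right, inner_add_right,
        real_inner_comm (H1grad u x) (G n x)]
      ring
    have ht1 : Tendsto (fun n => ∫ x in Λ, a n x * inner ℝ (H1grad u x) (H1grad u x)) atTop
        (𝓝 (∫ x in Λ, deriv g (H1fn u x) * inner ℝ (H1grad u x) (H1grad u x))) := by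
      have hI := L2.integrable_inner (𝕜 := ℝ) (H1grad u) (H1grad u)
      refine tendsto_integral_of_dominated_convergence
        (fun x => L * |inner ℝ (H1grad u x) (H1grad u x)|)
        (fun n => (hi n _ _).aestronglyMeasurable) (hI.abs.const_mul L)
        (fun n => Eventually.of_forall fun x => ?_) ?_
      · rw [norm_mul]
        exact mul_le_mul_of_nonneg_right (hL _) (abs_nonneg _)
      · filter_upwards [hae] with x hx
        exact ((hgd.tendsto _).comp hx).mul tendsto_const_nhds
    have ht2 : Tendsto (fun n => ∫ x in Λ, a n x * inner ℝ ((G n - H1grad u) x)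
        ((G n + H1grad u) x)) atTop (𝓝 0) := by
      have hb : Tendsto (fun n => L * ‖G n - H1grad u‖ * ‖G n + H1grad u‖) atTop (𝓝 0) := by
        have h1 := ((hgr'.sub_const (H1grad u)).norm.const_mul L).mul
          (hgr'.add_const (H1grad u)).norm
        simpa using h1
      exact squeeze_zero_norm (fun n => abs_integral_mul_inner_le (ham n) (fun x => hL _) _ _) hb
    have := ht1.add ht2
    rw [add_zero] at this
    exact this.congr fun n => (hsplit n).symm

end Calculus


/-! ### The energy estimate for one step of the scheme -/

section Step

variable {d : ℕ} {Λ : Set (Euc d)}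

lemma integral_mul_eq_inner (a b : L2 Λ ℝ) : ∫ x in Λ, a x * b x = inner ℝ a b := by
  rw [L2.inner_def]
  simp_rw [real_inner_eq_mul]

lemma integral_mul_eq_inner_of_ae_eq {k : Euc d → ℝ} {a : L2 Λ ℝ}
    (h : a =ᵐ[volume.restrict Λ] k) (b : L2 Λ ℝ) : ∫ x in Λ, k x * b x = inner ℝ a b := by
  rw [← integral_mul_eq_inner]
  refine integral_congr_ae ?_
  filter_upwards [h] with x hx
  rw [hx]

lemma laplacianNorm_le {u : H1 Λ} {z : L2 Λ ℝ} (hz : IsNeumannLaplacian u z) :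
    laplacianNorm u ≤ ‖z‖ₑ :=
  iInf₂_le z hz

/-- The algebra of adding the tests with `u` (`e1`) and `-Δu` (`e2`). Here `P = ⟨u - u', u⟩` in
`L²`, `g = ‖∇u‖²`, `Y = ⟨∇u, ∇u'⟩`, `a` and `b` are the two parts of the `H¹` product `⟨G, u⟩`, and
`nz`, `nl`, `nu` are the squares of `‖z‖`, `‖Δu‖`, `‖u‖`. -/
lemma energy_of_identities {τ δ K g P Du a Bu Y Dz b Bz nz nl nu : ℝ}
    (e1 : P + τ * g + τ * Du = δ * a + τ * Bu)
    (e2 : τ * nz = -g - -Y + τ * Dz - δ * -b - τ * Bz)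
    (h1 : τ * (Bu - Du + Dz - Bz) ≤ τ * (K * nu + K ^ 2 / 2 * nu + nz / 2))
    (h2 : τ * nl ≤ τ * nz) (h3 : 0 ≤ τ * g) :
    2 * (P + (g - Y)) + τ * nl ≤ 2 * δ * (a + b) + (2 * K + K ^ 2) * τ * nu := by
  linear_combination 2 * e1 + 2 * e2 + 2 * h1 + h2 + 2 * h3

/-- Testing the scheme with `u` and with `-Δu`. -/
lemma IsEulerStep.energy [IsFiniteMeasure (volume.restrict Λ)] (hΛ : IsOpen Λ)
    {g f β : ℝ → ℝ} (hg : ContDiff ℝ 1 g) {Lg : ℝ} (hLg : ∀ x, |deriv g x| ≤ Lg)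
    (hf : ContDiff ℝ 1 f) {Lf : ℝ} (hLf : ∀ x, |deriv f x| ≤ Lf)
    (hβ : ContDiff ℝ 1 β) {Lβ : ℝ} (hLβ : ∀ x, |deriv β x| ≤ Lβ) (hβ0 : β 0 = 0)
    {b : Euc d → Euc d} (hb : ContDiffOn ℝ 1 b Λ) {M : ℝ} (hM0 : 0 ≤ M) (hM : ∀ x ∈ Λ, ‖b x‖ ≤ M)
    (hdiv : ∀ x ∈ Λ, divergence b x = 0) {τ δ : ℝ} (hτ : 0 < τ) {u' u : H1 Λ}
    (h : IsEulerStep Λ τ δ g f β b u' u) :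
    laplacianNorm u ≠ ∞ ∧ ∃ G : H1 Λ, inner ℝ G u' = compPairing g u' ∧
      ‖G‖ ≤ (‖oneL2 Λ‖ + 2 * Lg) * (|g 0| + ‖u'‖) ∧
      ‖u‖ ^ 2 - ‖u'‖ ^ 2 + ‖u - u'‖ ^ 2 + τ * (laplacianNorm u).toReal ^ 2
        ≤ 2 * δ * inner ℝ G u
          + (2 * (Lf * M + Lβ) + (Lf * M + Lβ) ^ 2) * τ * ‖u‖ ^ 2 := by
  obtain ⟨D, hD, hw⟩ := h
  have hLg0 : 0 ≤ Lg := (abs_nonneg _).trans (hLg 0)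
  have hLf0 : 0 ≤ Lf := (abs_nonneg _).trans (hLf 0)
  have hLβ0 : 0 ≤ Lβ := (abs_nonneg _).trans (hLβ 0)
  have hDn := norm_weakDivergence_le hΛ hf hLf hb hM hdiv hD
  obtain ⟨G, hG1, hG2, hG3, hG4⟩ := H1.exists_comp hΛ hg hLg u'
  obtain ⟨B, hB, hBn⟩ := exists_comp_L2 hβ hLβ (H1fn u)
  rw [hβ0, abs_zero, zero_mul, zero_add] at hBn
  have hweak : ∀ w : H1 Λ, inner ℝ (H1fn u - H1fn u') (H1fn w)
      + τ * inner ℝ (H1grad u) (H1grad w) + τ * inner ℝ D (H1fn w)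
      = δ * inner ℝ (H1fn G) (H1fn w) + τ * inner ℝ B (H1fn w) := by
    intro w
    have h1 := hw w
    rw [integral_mul_eq_inner_of_ae_eq (k := fun x => H1fn u x - H1fn u' x) (Lp.coeFn_sub (H1fn u) (H1fn u')),
      integral_mul_eq_inner, integral_mul_eq_inner_of_ae_eq hB, ← L2.inner_def] at h1
    rw [h1]
    congr 1
    rw [← integral_mul_eq_inner_of_ae_eq hG1, ← integral_const_mul]
    congr 1; funext x; ring
  -- `z` is the value that the equation forces on `Δu`; comparison with the weak form shows that it
  -- is the Neumann Laplacian.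
  obtain ⟨z, hτz⟩ : ∃ z : L2 Λ ℝ, τ • z = H1fn u - H1fn u' + τ • D - δ • H1fn G - τ • B :=
    ⟨τ⁻¹ • _, smul_inv_smul₀ hτ.ne' _⟩
  have hzw : ∀ w : H1 Λ, inner ℝ z (H1fn w) = -inner ℝ (H1grad u) (H1grad w) := by
    intro w
    have h1 := hweak w
    have h2 : τ * inner ℝ z (H1fn w) = _ := (real_inner_smul_left z (H1fn w) τ).symm
    rw [hτz, inner_sub_left, inner_sub_left, inner_add_left, real_inner_smul_left,
      real_inner_smul_left, real_inner_smul_left] at h2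
    have : τ * (inner ℝ z (H1fn w) + inner ℝ (H1grad u) (H1grad w)) = 0 := by
      rw [mul_add, h2]; linarith
    rcases mul_eq_zero.1 this with h | h
    · exact absurd h hτ.ne'
    · linarith
  have hlap : IsNeumannLaplacian u z := fun w => by
    rw [integral_mul_eq_inner, hzw w, L2.inner_def]
  have hle := laplacianNorm_le hlap
  have hne : laplacianNorm u ≠ ∞ := (hle.trans_lt enorm_lt_top).ne
  have hreal : (laplacianNorm u).toReal ≤ ‖z‖ := by
    have := ENNReal.toReal_mono enorm_ne_top hle
    rwa [toReal_enorm] at this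
  refine ⟨hne, G, inner_eq_compPairing hG1 hG2, ?_, ?_⟩
  · have h1 := H1.norm_le G
    have h2 := mul_le_mul_of_nonneg_left (H1.norm_fn_le u') hLg0
    have h3 := mul_le_mul_of_nonneg_left (H1.norm_grad_le u') hLg0
    have h4 : 0 ≤ ‖oneL2 Λ‖ * ‖u'‖ := by positivity
    have h5 : 0 ≤ Lg * |g 0| := by positivity
    linarith
  · -- the two tested identities
    have e1 := hweak u
    have e2 : τ * inner ℝ z z = _ := (real_inner_smul_left z z τ).symm
    rw [hτz, inner_sub_left, inner_sub_left, inner_add_left, real_inner_smul_left,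
      real_inner_smul_left, real_inner_smul_left, inner_sub_left, real_inner_comm z (H1fn u),
      real_inner_comm z (H1fn u'), real_inner_comm z (H1fn G), hzw, hzw, hzw] at e2
    have e3 : inner ℝ G u = inner ℝ (H1fn G) (H1fn u) + inner ℝ (H1grad G) (H1grad u) :=
      H1.inner_eq G u
    have e4 : inner ℝ u (u - u') = inner ℝ (H1fn u - H1fn u') (H1fn u)
        + (inner ℝ (H1grad u) (H1grad u) - inner ℝ (H1grad u) (H1grad u')) := by
      rw [← inner_sub_right, real_inner_comm]
      rw [H1.inner_eq, real_inner_comm (H1grad u) (H1grad (u - u'))]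
      rfl
    have e5 : ‖u‖ ^ 2 - ‖u'‖ ^ 2 + ‖u - u'‖ ^ 2 = 2 * inner ℝ u (u - u') := by
      rw [@norm_sub_sq_real, inner_sub_right, real_inner_self_eq_norm_sq]; ring
    rw [real_inner_comm (H1grad u) (H1grad G)] at e3
    rw [real_inner_self_eq_norm_sq] at e1 e2 e4
    rw [real_inner_self_eq_norm_sq (H1grad u)] at e2
    set K := Lf * M + Lβ with hK
    have hK0 : 0 ≤ K := by positivity
    have hDB : ‖D‖ + ‖B‖ ≤ K * ‖u‖ := by
      have h2 := mul_le_mul_of_nonneg_left (H1.norm_fn_le u) hLβ0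
      have h3 := mul_le_mul_of_nonneg_left (H1.norm_grad_le u) (mul_nonneg hLf0 hM0)
      rw [hK]; linarith
    have i1 : |inner ℝ B (H1fn u)| ≤ ‖B‖ * ‖u‖ :=
      (abs_real_inner_le_norm _ _).trans
        (mul_le_mul_of_nonneg_left (H1.norm_fn_le u) (norm_nonneg _))
    have i2 : |inner ℝ D (H1fn u)| ≤ ‖D‖ * ‖u‖ :=
      (abs_real_inner_le_norm _ _).trans
        (mul_le_mul_of_nonneg_left (H1.norm_fn_le u) (norm_nonneg _))
    have i3 := abs_real_inner_le_norm B z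
    have i4 := abs_real_inner_le_norm D z
    -- Young's inequality on `K‖u‖‖z‖` uses half of `‖z‖²`; the other half stays on the left of the
    -- energy estimate.
    have hbr : inner ℝ B (H1fn u) - inner ℝ D (H1fn u) + inner ℝ D z - inner ℝ B z
        ≤ K * ‖u‖ ^ 2 + K ^ 2 / 2 * ‖u‖ ^ 2 + ‖z‖ ^ 2 / 2 := by
      have j1 := (abs_le.1 i1).2
      have j2 := (abs_le.1 i2).1
      have j3 := (abs_le.1 i3).1
      have j4 := (abs_le.1 i4).2
      have j5 : (‖D‖ + ‖B‖) * ‖u‖ ≤ K * ‖u‖ * ‖u‖ :=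
        mul_le_mul_of_nonneg_right hDB (norm_nonneg _)
      have j6 : (‖D‖ + ‖B‖) * ‖z‖ ≤ K * ‖u‖ * ‖z‖ :=
        mul_le_mul_of_nonneg_right hDB (norm_nonneg _)
      nlinarith [sq_nonneg (K * ‖u‖ - ‖z‖)]
    have hbr' := mul_le_mul_of_nonneg_left hbr hτ.le
    have hz2 : τ * (laplacianNorm u).toReal ^ 2 ≤ τ * ‖z‖ ^ 2 := by gcongr
    have hg2 : 0 ≤ τ * ‖H1grad u‖ ^ 2 := by positivity
    rw [e5, e4, e3]
    exact energy_of_identities e1 e2 hbr' hz2 hg2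

end Step


/-! ### Powers of the energy estimate -/

/-- The weight `∏ (x^(2^l) + y^(2^l))`. -/
def weight (r : ℕ) (x y : ℝ) : ℝ := ∏ l ∈ Finset.Icc 1 r, (x ^ (2 ^ l) + y ^ (2 ^ l))

/-- The degree of homogeneity of `weight r`. -/
def weightDeg (r : ℕ) : ℕ := 2 * (2 ^ r - 1)

lemma weightDeg_succ (r : ℕ) : weightDeg (r + 1) = weightDeg r + 2 ^ (r + 1) := by
  have := Nat.one_le_two_pow (n := r)
  rw [weightDeg, weightDeg, pow_succ]; omega

lemma weight_succ (r : ℕ) (x y : ℝ) :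
    weight (r + 1) x y = weight r x y * (x ^ (2 ^ (r + 1)) + y ^ (2 ^ (r + 1))) := by
  rw [weight, Finset.prod_Icc_succ_top (by omega)]; rfl

lemma weight_zero (x y : ℝ) : weight 0 x y = 1 := by simp [weight]

lemma weight_nonneg (r : ℕ) {x y : ℝ} (hx : 0 ≤ x) (hy : 0 ≤ y) : 0 ≤ weight r x y :=
  Finset.prod_nonneg fun l _ => by positivity

/-- Each factor of the product turns a difference of powers `2^l` into one of powers `2^(l+1)`. -/
lemma sq_sub_sq_mul_weight (r : ℕ) (x y : ℝ) :
    (x ^ 2 - y ^ 2) * weight r x y = x ^ (2 ^ (r + 1)) - y ^ (2 ^ (r + 1)) := by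
  induction r with
  | zero => simp [weight_zero]
  | succ r ih =>
    rw [weight_succ, ← mul_assoc, ih, pow_succ 2 (r + 1), pow_mul, pow_mul]; ring

lemma weight_le (r : ℕ) {x y : ℝ} (hx : 0 ≤ x) (hy : 0 ≤ y) :
    weight r x y ≤ (x + y) ^ weightDeg r := by
  induction r with
  | zero => simp [weight_zero, weightDeg]
  | succ r ih =>
    rw [weight_succ, weightDeg_succ, pow_add (x + y)]
    exact mul_le_mul ih (pow_add_pow_le hx hy (pow_ne_zero _ two_ne_zero)) (by positivity) (by positivity)

lemma pow_weightDeg_le (r : ℕ) {x y : ℝ} (hx : 0 ≤ x) (hy : 0 ≤ y) :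
    (x + y) ^ weightDeg r ≤ 2 ^ weightDeg r * weight r x y := by
  induction r with
  | zero => simp [weight_zero, weightDeg]
  | succ r ih =>
    have h1 : (x + y) ^ (2 ^ (r + 1)) ≤ 2 ^ (2 ^ (r + 1)) * (x ^ (2 ^ (r + 1)) + y ^ (2 ^ (r + 1))) :=
      (add_pow_le hx hy _).trans (mul_le_mul_of_nonneg_right
        (pow_le_pow_right₀ one_le_two (Nat.sub_le _ _)) (by positivity))
    rw [weight_succ, weightDeg_succ, pow_add, pow_add]
    calc _ ≤ (2 ^ weightDeg r * weight r x y)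
          * (2 ^ (2 ^ (r + 1)) * (x ^ (2 ^ (r + 1)) + y ^ (2 ^ (r + 1)))) :=
        mul_le_mul ih h1 (by positivity) (mul_nonneg (by positivity) (weight_nonneg r hx hy))
      _ = _ := by ring

lemma weight_self (r : ℕ) (y : ℝ) : weight r y y = 2 ^ r * y ^ weightDeg r := by
  induction r with
  | zero => simp [weight_zero, weightDeg]
  | succ r ih => rw [weight_succ, weightDeg_succ, ih, pow_add, pow_succ 2 r]; ring

/-- A homogeneous Lipschitz bound, by the product rule for differences. The factor `x + y` on the
left avoids the exponent `weightDeg r - 1`, which degenerates at `r = 0`. -/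
lemma exists_abs_weight_sub_le (r : ℕ) : ∃ c : ℝ, 0 ≤ c ∧ ∀ x y : ℝ, 0 ≤ x → 0 ≤ y →
    |weight r x y - weight r y y| * (x + y) ≤ c * |x - y| * (x + y) ^ weightDeg r := by
  induction r with
  | zero => exact ⟨0, le_rfl, fun x y _ _ => by simp [weight_zero]⟩
  | succ r ih =>
    obtain ⟨c, hc, h⟩ := ih
    set n := 2 ^ (r + 1) with hn
    have hn1 : n ≠ 0 := by positivity
    refine ⟨c + 2 ^ weightDeg r * n, by positivity, fun x y hx hy => ?_⟩
    have h1 := h x y hx hy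
    have hs : 0 ≤ x + y := add_nonneg hx hy
    have h2 : x ^ n + y ^ n ≤ (x + y) ^ n := pow_add_pow_le hx hy hn1
    have h3 : |x ^ n - y ^ n| * (x + y) ≤ |x - y| * n * (x + y) ^ n := by
      have h4 := abs_pow_sub_pow_le x y n
      have h5 : max |x| |y| ≤ x + y := by
        rw [abs_of_nonneg hx, abs_of_nonneg hy]; exact max_le (by linarith) (by linarith)
      calc |x ^ n - y ^ n| * (x + y) ≤ (|x - y| * n * (x + y) ^ (n - 1)) * (x + y) := by
            refine mul_le_mul_of_nonneg_right (h4.trans ?_) hs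
            gcongr
        _ = |x - y| * n * (x + y) ^ n := by
            rw [mul_assoc _ _ (x + y), pow_sub_one_mul hn1]
    have h6 : weight r y y ≤ 2 ^ weightDeg r * (x + y) ^ weightDeg r := by
      refine (weight_le r hy hy).trans ?_
      rw [← mul_pow]
      gcongr
      linarith
    have h7 : weight (r + 1) x y - weight (r + 1) y y
        = (weight r x y - weight r y y) * (x ^ n + y ^ n)
          + weight r y y * (x ^ n - y ^ n) := by
      rw [weight_succ, weight_succ]; ring
    have hw := weight_nonneg r hy hy
    rw [h7, weightDeg_succ, pow_add]
    calc _ ≤ (|weight r x y - weight r y y| * (x ^ n + y ^ n)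
            + weight r y y * |x ^ n - y ^ n|) * (x + y) := by
          gcongr
          refine (abs_add_le _ _).trans (le_of_eq ?_)
          rw [abs_mul, abs_mul, abs_of_nonneg hw, abs_of_nonneg (by positivity : 0 ≤ x ^ n + y ^ n)]
      _ = (|weight r x y - weight r y y| * (x + y)) * (x ^ n + y ^ n)
            + weight r y y * (|x ^ n - y ^ n| * (x + y)) := by ring
      _ ≤ (c * |x - y| * (x + y) ^ weightDeg r) * (x + y) ^ n
            + (2 ^ weightDeg r * (x + y) ^ weightDeg r) * (|x - y| * n * (x + y) ^ n) := by
          gcongr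
      _ = _ := by ring

/-- Here `x, y, e, n` stand for the norms of `u`, `u'`, `u - u'`, `G`, while `p, s` are the products
of `G` with `u - u'` and `u'`, and `q = ‖Δu‖`. The energy inequality is used twice: with `C₀τ ≤ 1/2`
it bounds `x` by `y` and `δ`, and multiplied by the weight it gives the claim. The remainder is a
product of a function of `δ` and one of `y`, ready for independence. -/
lemma exists_energy_pow_scalar (r : ℕ) {C₀ C₁ : ℝ} (hC₀ : 0 ≤ C₀) :
    ∃ C : ℝ, 0 ≤ C ∧ ∀ x y e n p s τ δ q γ : ℝ, 0 ≤ x → 0 ≤ y → 0 ≤ e → 0 ≤ n → |x - y| ≤ e →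
      |p| ≤ n * e → |s| ≤ n * y → 0 ≤ τ → C₀ * τ ≤ 1 / 2 → n ≤ C₁ * (|γ| + y) →
      x ^ 2 - y ^ 2 + e ^ 2 + τ * q ^ 2 ≤ 2 * δ * (p + s) + C₀ * τ * x ^ 2 →
      x ^ (2 ^ (r + 1)) + 1 / 4 * (weight r x y * (e ^ 2 + τ * q ^ 2))
        ≤ y ^ (2 ^ (r + 1)) + δ * (2 * weight r y y * s)
          + C * ((δ ^ 2 + τ) * (1 + δ ^ 2) ^ (2 ^ r)) * (γ ^ 2 + y ^ 2) ^ (2 ^ r) := by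
  obtain ⟨c₀, hc₀, hc⟩ := exists_abs_weight_sub_le r
  obtain ⟨c, hcdef⟩ : ∃ c, c = c₀ * 2 ^ weightDeg r := ⟨_, rfl⟩
  -- Chosen so that `(x + y)² ≤ 10y² + 8δ²n² ≤ K D R`, with `D = 1 + δ²` and `R = γ² + y²`.
  obtain ⟨K, hK⟩ : ∃ K, K = 10 + 16 * C₁ ^ 2 := ⟨_, rfl⟩
  obtain ⟨k, hk⟩ : ∃ k, k = 2 ^ r - 1 := ⟨_, rfl⟩
  have hk1 : 2 ^ r = k + 1 := by have := Nat.one_le_two_pow (n := r); omega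
  have hc_nonneg : 0 ≤ c := by rw [hcdef]; positivity
  have hK0 : 0 ≤ K := by rw [hK]; positivity
  refine ⟨K ^ k * (2 * C₁ ^ 2 * (2 + 4 * c ^ 2) + C₀ * K), by positivity, ?_⟩
  intro x y e n p s τ δ q γ hx0 hy0 he0 hn0 hxy hi1 hi2 hτ hτ1 hG H
  obtain ⟨R, hR⟩ : ∃ R, R = γ ^ 2 + y ^ 2 := ⟨_, rfl⟩
  rw [← hR]
  have hR0 : 0 ≤ R := by rw [hR]; positivity
  have hnR : n ^ 2 ≤ 2 * C₁ ^ 2 * R := by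
    calc n ^ 2 ≤ (C₁ * (|γ| + y)) ^ 2 := by gcongr
      _ = C₁ ^ 2 * (|γ| + y) ^ 2 := by ring
      _ ≤ C₁ ^ 2 * (2 * (γ ^ 2 + y ^ 2)) := by
          gcongr
          nlinarith only [sq_nonneg (|γ| - y), sq_abs γ]
      _ = _ := by rw [hR]; ring
  have hd1 : δ * p ≤ |δ| * n * e := by
    calc _ ≤ |δ * p| := le_abs_self _
      _ ≤ |δ| * (n * e) := by rw [abs_mul]; gcongr
      _ = _ := by ring
  have hd2 : δ * s ≤ |δ| * n * y := by
    calc _ ≤ |δ * s| := le_abs_self _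
      _ ≤ |δ| * (n * y) := by rw [abs_mul]; gcongr
      _ = _ := by ring
  have hδn : (|δ| * n) ^ 2 = δ ^ 2 * n ^ 2 := by rw [mul_pow, sq_abs]
  have hq : 0 ≤ τ * q ^ 2 := by positivity
  obtain ⟨D, hD⟩ : ∃ D, D = 1 + δ ^ 2 := ⟨_, rfl⟩
  rw [← hD]
  have hD1 : 1 ≤ D := by rw [hD]; linarith [sq_nonneg δ]
  -- the size of the new iterate
  have hx2 : x ^ 2 ≤ 4 * y ^ 2 + 4 * (δ ^ 2 * n ^ 2) := by
    have h1 : C₀ * τ * x ^ 2 ≤ 1 / 2 * x ^ 2 := by gcongr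
    have h2 := sq_nonneg (|δ| * n - e)
    have h3 := sq_nonneg (|δ| * n - y)
    nlinarith only [h1, h2, h3, hδn, H, hd1, hd2, hq]
  have hδR : δ ^ 2 * n ^ 2 ≤ 2 * C₁ ^ 2 * (D * R) := by
    calc δ ^ 2 * n ^ 2 ≤ D * (2 * C₁ ^ 2 * R) := by
          gcongr
          rw [hD]; linarith
      _ = _ := by ring
  have hyDR : y ^ 2 ≤ D * R := by
    have : y ^ 2 ≤ R := by rw [hR]; linarith [sq_nonneg γ]
    exact this.trans (le_mul_of_one_le_left hR0 hD1)
  have hDR : 0 ≤ D * R := by positivity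
  have hs2 : (x + y) ^ 2 ≤ K * (D * R) := by
    have h1 : (x + y) ^ 2 ≤ 2 * x ^ 2 + 2 * y ^ 2 := by nlinarith only [sq_nonneg (x - y)]
    have h2 : K * (D * R) = 10 * (D * R) + 16 * (C₁ ^ 2 * (D * R)) := by rw [hK]; ring
    linarith
  have hx2' : x ^ 2 ≤ K * (D * R) := by
    refine le_trans ?_ hs2
    gcongr; linarith
  have hse : (x + y) ^ weightDeg r ≤ K ^ k * (D ^ k * R ^ k) := by
    rw [weightDeg, ← hk, pow_mul, ← mul_pow, ← mul_pow]
    gcongr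
  have hpow := sq_sub_sq_mul_weight r x y
  have hcxy := hc x y hx0 hy0
  have hsQ := pow_weightDeg_le r hx0 hy0
  have hQ0 := weight_nonneg r hx0 hy0
  have hQs := weight_le r hx0 hy0
  obtain ⟨Q₀, hQ₀⟩ : ∃ Q₀, Q₀ = weight r y y := ⟨_, rfl⟩
  obtain ⟨Q, hQ⟩ : ∃ Q, Q = weight r x y := ⟨_, rfl⟩
  rw [← hQ] at hpow hcxy hsQ hQ0 hQs ⊢
  rw [← hQ₀] at hcxy ⊢
  -- the noise term
  have hn1 : Q * (2 * (δ * p)) ≤ Q * (1 / 2 * e ^ 2 + 2 * (δ ^ 2 * n ^ 2)) := by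
    gcongr
    nlinarith only [sq_nonneg (2 * (|δ| * n) - e), hδn, hd1]
  -- Passing from `Q` to `Q₀` costs `e²/4`; with the `e²/2` spent in `hn1` this leaves the factor
  -- `1/4` of the claim.
  have hn2 : 2 * ((Q - Q₀) * (δ * s))
      ≤ Q * (1 / 4 * e ^ 2 + 4 * c ^ 2 * (δ ^ 2 * n ^ 2)) := by
    have h1 : |Q - Q₀| * (x + y) ≤ c * e * Q := by
      calc _ ≤ c₀ * |x - y| * (x + y) ^ weightDeg r  := hcxy
        _ ≤ c₀ * e * (2 ^ weightDeg r * Q) := by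
            gcongr
        _ = _ := by rw [hcdef]; ring
    have h2 : (Q - Q₀) * (δ * s) ≤ c * e * Q * (|δ| * n) := by
      calc _ ≤ |(Q - Q₀) * (δ * s)| := le_abs_self _
        _ = |Q - Q₀| * (|δ| * |s|) := by rw [abs_mul, abs_mul]
        _ ≤ |Q - Q₀| * (|δ| * (n * (x + y))) := by
            gcongr
            exact hi2.trans (by gcongr; linarith)
        _ = (|Q - Q₀| * (x + y)) * (|δ| * n) := by ring
        _ ≤ _ := by gcongr
    have h3 : 2 * (c * e * (|δ| * n)) ≤ 1 / 4 * e ^ 2 + 4 * c ^ 2 * (δ ^ 2 * n ^ 2) := by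
      rw [← hδn]
      nlinarith only [sq_nonneg (1 / 2 * e - 2 * c * (|δ| * n))]
    calc _ ≤ Q * (2 * (c * e * (|δ| * n))) := by linarith
      _ ≤ _ := by gcongr
  have hH := mul_le_mul_of_nonneg_left H hQ0
  -- `Q` contributes `(D R)^k` with `k = 2^r - 1`, the bracket one more factor `D R` together with
  -- `δ² + τ`.
  have hrest : Q * ((2 + 4 * c ^ 2) * (δ ^ 2 * n ^ 2) + C₀ * τ * x ^ 2)
      ≤ K ^ k * (2 * C₁ ^ 2 * (2 + 4 * c ^ 2) + C₀ * K) * ((δ ^ 2 + τ) * D ^ (2 ^ r))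
        * R ^ (2 ^ r) := by
    have h1 : (2 + 4 * c ^ 2) * (δ ^ 2 * n ^ 2) + C₀ * τ * x ^ 2
        ≤ (2 * C₁ ^ 2 * (2 + 4 * c ^ 2) + C₀ * K) * ((δ ^ 2 + τ) * (D * R)) := by
      have h2 : δ ^ 2 * n ^ 2 ≤ (δ ^ 2 + τ) * (2 * C₁ ^ 2 * (D * R)) := by
        have : R ≤ D * R := le_mul_of_one_le_left hR0 hD1
        gcongr
        · linarith
        · exact hnR.trans (by gcongr)
      have h3 : C₀ * τ * x ^ 2 ≤ C₀ * (δ ^ 2 + τ) * (K * (D * R)) := by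
        gcongr
        linarith [sq_nonneg δ]
      calc _ ≤ (2 + 4 * c ^ 2) * ((δ ^ 2 + τ) * (2 * C₁ ^ 2 * (D * R)))
            + C₀ * (δ ^ 2 + τ) * (K * (D * R)) := by gcongr
        _ = _ := by ring
    calc _ ≤ (K ^ k * (D ^ k * R ^ k))
          * ((2 * C₁ ^ 2 * (2 + 4 * c ^ 2) + C₀ * K) * ((δ ^ 2 + τ) * (D * R))) := by
          refine mul_le_mul (hQs.trans hse) h1 (by positivity) (by positivity)
      _ = _ := by rw [hk1, pow_succ D k, pow_succ R k]; ring
  have hQq : 0 ≤ Q * (τ * q ^ 2) := mul_nonneg hQ0 hq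
  linarith

/-- The energy estimate implies an estimate for the power `2^(r+1)` of the norm. -/
lemma exists_energy_pow (r : ℕ) {C₀ C₁ : ℝ} (hC₀ : 0 ≤ C₀) :
    ∃ C : ℝ, 0 ≤ C ∧ ∀ {E : Type} [NormedAddCommGroup E] [InnerProductSpace ℝ E] (u u' G : E)
      (τ δ q γ : ℝ), 0 ≤ τ → C₀ * τ ≤ 1 / 2 → ‖G‖ ≤ C₁ * (|γ| + ‖u'‖) →
      ‖u‖ ^ 2 - ‖u'‖ ^ 2 + ‖u - u'‖ ^ 2 + τ * q ^ 2
        ≤ 2 * δ * inner ℝ G u + C₀ * τ * ‖u‖ ^ 2 →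
      ‖u‖ ^ (2 ^ (r + 1)) + 1 / 4 * (weight r ‖u‖ ‖u'‖ * (‖u - u'‖ ^ 2 + τ * q ^ 2))
        ≤ ‖u'‖ ^ (2 ^ (r + 1)) + δ * (2 * weight r ‖u'‖ ‖u'‖ * inner ℝ G u')
          + C * ((δ ^ 2 + τ) * (1 + δ ^ 2) ^ (2 ^ r)) * (γ ^ 2 + ‖u'‖ ^ 2) ^ (2 ^ r) := by
  obtain ⟨C, hC, h⟩ := exists_energy_pow_scalar r (C₁ := C₁) hC₀
  refine ⟨C, hC, fun {E} _ _ u u' G τ δ q γ hτ hτ1 hG H => ?_⟩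
  refine h _ _ _ _ (inner ℝ G (u - u')) _ τ δ q γ (norm_nonneg _) (norm_nonneg _) (norm_nonneg _)
    (norm_nonneg G) (abs_norm_sub_norm_le u u') (abs_real_inner_le_norm _ _)
    (abs_real_inner_le_norm _ _) hτ hτ1 hG ?_
  rwa [← inner_add_right, sub_add_cancel]


/-! ### Moments of the increments and the expectation of the energy estimate -/

lemma integrable_one_add_sq_pow (v : ℝ≥0) (k : ℕ) :
    Integrable (fun x : ℝ => (1 + x ^ 2) ^ k) (gaussianReal 0 v) := by
  have h : MemLp (fun x : ℝ => 1 + |x|) ((2 * k : ℕ) : ℝ≥0∞) (gaussianReal 0 v) :=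
    MemLp.add (f := fun _ => (1 : ℝ)) (g := fun x : ℝ => |x|) (memLp_const 1)
      (MemLp.abs (f := fun x : ℝ => x) (memLp_id_gaussianReal' _ (ENNReal.natCast_ne_top (2 * k))))
  refine h.integrable_norm_pow'.mono' (by fun_prop) (Filter.Eventually.of_forall fun x => ?_)
  rw [Real.norm_of_nonneg (by positivity), Real.norm_of_nonneg (by positivity), pow_mul]
  gcongr
  nlinarith [abs_nonneg x, sq_abs x]

/-- The moments of a centered Gaussian variable of variance `τ ≤ T` are `O(τ)`. -/
lemma exists_gaussian_moment_le {T : ℝ} (hT : 0 ≤ T) (k : ℕ) :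
    ∃ K : ℝ, 0 ≤ K ∧ ∀ v : ℝ≥0, (v : ℝ) ≤ T →
      Integrable (fun x : ℝ => (x ^ 2 + v) * (1 + x ^ 2) ^ k) (gaussianReal 0 v) ∧
      ∫ x, (x ^ 2 + v) * (1 + x ^ 2) ^ k ∂gaussianReal 0 v ≤ K * v := by
  refine ⟨(1 + T) ^ k * ∫ x, (1 + x ^ 2) ^ (k + 1) ∂gaussianReal 0 1,
    mul_nonneg (by positivity) (integral_nonneg fun x => by positivity), fun v hv => ⟨?_, ?_⟩⟩
  · refine ((integrable_one_add_sq_pow v (k + 1)).const_mul (1 + T)).mono' (by fun_prop)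
      (Filter.Eventually.of_forall fun x => ?_)
    rw [Real.norm_of_nonneg (by positivity), pow_succ _ k, mul_comm _ (1 + x ^ 2), ← mul_assoc]
    gcongr
    nlinarith [sq_nonneg x, mul_nonneg hT (sq_nonneg x)]
  -- Scaling to unit variance brings out the factor `v`; the remaining moment does not depend on
  -- `v`.
  · have hmap : gaussianReal 0 v = (gaussianReal 0 1).map (fun x => √(v : ℝ) * x) := by
      rw [gaussianReal_map_const_mul, mul_zero, mul_one]
      congr 1
      ext
      simp
    rw [hmap, integral_map (by fun_prop) (by fun_prop), mul_assoc, mul_comm _ (v : ℝ), ← mul_assoc,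
      ← integral_const_mul]
    refine integral_mono_of_nonneg (Filter.Eventually.of_forall fun x => by positivity)
      ((integrable_one_add_sq_pow 1 (k + 1)).const_mul _) (Filter.Eventually.of_forall fun x => ?_)
    have hsq : (√(v : ℝ) * x) ^ 2 = v * x ^ 2 := by rw [mul_pow, Real.sq_sqrt v.coe_nonneg]
    simp only [hsq]
    have h1 : 1 + v * x ^ 2 ≤ (1 + T) * (1 + x ^ 2) := by
      have : v * x ^ 2 ≤ T * x ^ 2 := by gcongr
      nlinarith [sq_nonneg x]
    calc (v * x ^ 2 + v) * (1 + v * x ^ 2) ^ k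
        ≤ (v * x ^ 2 + v) * ((1 + T) * (1 + x ^ 2)) ^ k := by gcongr
      _ = _ := by rw [mul_pow, pow_succ]; ring

lemma indepFun_of_indep_comap {Ω : Type*} {m mΩ : MeasurableSpace Ω} {P : Measure Ω}
    {δ X : Ω → ℝ}
    (h : Indep (MeasurableSpace.comap δ inferInstance) m P) (hX : Measurable[m] X) :
    IndepFun δ X P :=
  (IndepFun_iff_Indep _ _ _).2 (indep_of_indep_of_le_right h hX.comap_le)

/-- Taking the expectation of an energy estimate whose noise terms are independent of the past. -/
lemma lintegral_energy_le {Ω : Type*} {m mΩ : MeasurableSpace Ω} {P : Measure Ω}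
    [IsProbabilityMeasure P] {δ : Ω → ℝ} {v : ℝ≥0}
    (hδ : HasLaw δ (gaussianReal 0 v) P)
    (hind : Indep (MeasurableSpace.comap δ inferInstance) m P)
    {ψ : ℝ → ℝ} (hψ : Continuous ψ) (hψi : Integrable ψ (gaussianReal 0 v)) {K C : ℝ}
    (hψK : ∫ x, ψ x ∂gaussianReal 0 v ≤ K) (hC : 0 ≤ C)
    {a b X Y w : Ω → ℝ} (ha : AEStronglyMeasurable a P) (ha0 : ∀ ω, 0 ≤ a ω) (hw0 : ∀ ω, 0 ≤ w ω)
    (hb : Integrable b P) (hX : Measurable[m] X) (hXi : Integrable X P)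
    (hY : Measurable[m] Y) (hYi : Integrable Y P) (hY0 : ∀ ω, 0 ≤ Y ω)
    (h : ∀ᵐ ω ∂P, a ω + 1 / 4 * w ω ≤ b ω + δ ω * X ω + C * ψ (δ ω) * Y ω) :
    Integrable a P ∧ ENNReal.ofReal (∫ ω, a ω ∂P)
        + ENNReal.ofReal (1 / 4) * ∫⁻ ω, ENNReal.ofReal (w ω) ∂P
      ≤ ENNReal.ofReal (∫ ω, b ω ∂P + C * K * ∫ ω, Y ω ∂P) := by
  have hδX := indepFun_of_indep_comap hind hX
  have hδY : IndepFun (fun ω => ψ (δ ω)) Y P :=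
    (indepFun_of_indep_comap hind hY).comp hψ.measurable measurable_id
  have hδi : Integrable δ P := by
    have : Integrable (fun x : ℝ => x) (P.map δ) := by
      rw [hδ.map_eq]
      exact (memLp_id_gaussianReal 1).integrable le_rfl
    exact (integrable_map_measure this.aestronglyMeasurable hδ.aemeasurable).1 this
  have hψδ : Integrable (fun ω => ψ (δ ω)) P := by
    have : Integrable ψ (P.map δ) := by rwa [hδ.map_eq]
    exact (integrable_map_measure this.aestronglyMeasurable hδ.aemeasurable).1 this
  have hi1 : Integrable (fun ω => δ ω * X ω) P := hδX.integrable_mul hδi hXi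
  have hi2 : Integrable (fun ω => ψ (δ ω) * Y ω) P := hδY.integrable_mul hψδ hYi
  have hi2' : Integrable (fun ω => C * ψ (δ ω) * Y ω) P := by
    simpa only [mul_assoc] using hi2.const_mul C
  have hR : Integrable (fun ω => b ω + δ ω * X ω + C * ψ (δ ω) * Y ω) P := (hb.add hi1).add hi2'
  have hδ0 : ∫ ω, δ ω ∂P = 0 := by rw [hδ.integral_eq, integral_id_gaussianReal]
  have hψE : ∫ ω, ψ (δ ω) ∂P ≤ K := by
    have := hδ.integral_comp hψi.aestronglyMeasurable
    exact this.trans_le hψK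
  have hintR : ∫ ω, (b ω + δ ω * X ω + C * ψ (δ ω) * Y ω) ∂P
      ≤ ∫ ω, b ω ∂P + C * K * ∫ ω, Y ω ∂P := by
    have e1 : ∫ ω, δ ω * X ω ∂P = 0 := by
      rw [hδX.integral_fun_mul_eq_mul_integral hδi.aestronglyMeasurable hXi.aestronglyMeasurable,
        hδ0, zero_mul]
    have e2 : ∫ ω, C * ψ (δ ω) * Y ω ∂P = C * ((∫ ω, ψ (δ ω) ∂P) * ∫ ω, Y ω ∂P) := by
      rw [← hδY.integral_fun_mul_eq_mul_integral hψδ.aestronglyMeasurable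
        hYi.aestronglyMeasurable, ← integral_const_mul]
      simp only [mul_assoc]
    have hb1 : Integrable (fun ω => b ω + δ ω * X ω) P := hb.add hi1
    rw [integral_add hb1 hi2', integral_add hb hi1, e1, e2, add_zero, mul_assoc]
    have := integral_nonneg (μ := P) (f := Y) fun ω => hY0 ω
    gcongr
  have hai : Integrable a P := by
    refine hR.mono' ha ?_
    filter_upwards [h] with ω hω
    rw [Real.norm_of_nonneg (ha0 ω)]
    linarith [hw0 ω]
  refine ⟨hai, ?_⟩
  -- Only `a` has to be measurable to split the lower integral; nothing is needed of `w`, which will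
  -- contain `‖Δu‖`.
  rw [ofReal_integral_eq_lintegral_ofReal hai (Filter.Eventually.of_forall ha0),
    ← lintegral_const_mul' _ _ ENNReal.ofReal_ne_top,
    ← lintegral_add_left' hai.aestronglyMeasurable.aemeasurable.ennreal_ofReal]
  refine le_trans ?_ (ENNReal.ofReal_le_ofReal hintR)
  rw [ofReal_integral_eq_lintegral_ofReal hR]
  · refine lintegral_mono_ae ?_
    filter_upwards [h] with ω hω
    rw [← ENNReal.ofReal_mul (by norm_num), ← ENNReal.ofReal_add (ha0 ω)
      (mul_nonneg (by norm_num) (hw0 ω))]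
    exact ENNReal.ofReal_le_ofReal hω
  · filter_upwards [h] with ω hω
    exact (add_nonneg (ha0 ω) (mul_nonneg (by norm_num) (hw0 ω))).trans hω

/-- A discrete Gronwall inequality. -/
lemma energy_gronwall {N : ℕ} {τ T Θ Γ : ℝ} (hτ : 0 ≤ τ) (hNτ : N * τ = T) (hΘ : 0 ≤ Θ)
    (hΓ : 0 ≤ Γ) {A S : ℕ → ℝ} (hA : ∀ n, 0 ≤ A n) (hS : ∀ n, 0 ≤ S n)
    (h : ∀ n ∈ Finset.Icc 1 N, A n + 1 / 4 * S n ≤ A (n - 1) + Θ * τ * (Γ + A (n - 1))) :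
    (∀ n ≤ N, A n ≤ Real.exp (Θ * T) * (Γ + A 0)) ∧
      ∑ n ∈ Finset.Icc 1 N, S n ≤ 4 * (1 + Θ * T * Real.exp (Θ * T)) * (Γ + A 0) := by
  have hΘτ : 0 ≤ Θ * τ := mul_nonneg hΘ hτ
  -- Adding `Γ` to `A` makes the affine recursion geometric.
  have h1 : ∀ n ≤ N, Γ + A n ≤ Real.exp (Θ * (n * τ)) * (Γ + A 0) := by
    intro n
    induction n with
    | zero => intro _; simp
    | succ n ih =>
      intro hn
      have h2 := h (n + 1) (Finset.mem_Icc.2 ⟨by omega, hn⟩)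
      rw [Nat.add_sub_cancel] at h2
      have h3 := ih (by omega)
      have h4 : 1 + Θ * τ ≤ Real.exp (Θ * τ) := by linarith [Real.add_one_le_exp (Θ * τ)]
      calc Γ + A (n + 1) ≤ (1 + Θ * τ) * (Γ + A n) := by
            linarith [hS (n + 1)]
        _ ≤ Real.exp (Θ * τ) * (Real.exp (Θ * (n * τ)) * (Γ + A 0)) :=
            mul_le_mul h4 h3 (add_nonneg hΓ (hA n)) (Real.exp_pos _).le
        _ = _ := by
            rw [← mul_assoc, ← Real.exp_add]; push_cast; congr 2; ring
  have h0 : 0 ≤ Γ + A 0 := add_nonneg hΓ (hA 0)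
  have hT : 0 ≤ T := by rw [← hNτ]; positivity
  have h2 : ∀ n ≤ N, Γ + A n ≤ Real.exp (Θ * T) * (Γ + A 0) := fun n hn => by
    refine (h1 n hn).trans ?_
    gcongr
    rw [← hNτ]
    gcongr
  refine ⟨fun n hn => by linarith [h2 n hn], ?_⟩
  have h3 : ∀ n ≤ N, A n + 1 / 4 * ∑ j ∈ Finset.Icc 1 n, S j
      ≤ A 0 + n * τ * (Θ * (Real.exp (Θ * T) * (Γ + A 0))) := by
    intro n
    induction n with
    | zero => intro _; simp
    | succ n ih =>
      intro hn
      have h4 := h (n + 1) (Finset.mem_Icc.2 ⟨by omega, hn⟩)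
      rw [Nat.add_sub_cancel] at h4
      have h5 := ih (by omega)
      have h6 := mul_le_mul_of_nonneg_left (h2 n (by omega)) hΘτ
      rw [Finset.sum_Icc_succ_top (by omega)]
      push_cast
      linarith
  have h4 := h3 N le_rfl
  rw [hNτ] at h4
  linarith [hA N]


/-! ### The estimate for the scheme -/

lemma IsVelocity.contDiffOn_slice {d : ℕ} {Λ : Set (Euc d)} {T : ℝ} {vel : ℝ → Euc d → Euc d}
    (h : IsVelocity Λ T vel) {t : ℝ} (ht : t ∈ Icc 0 T) : ContDiffOn ℝ 1 (vel t) Λ :=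
  h.contDiffOn.comp (contDiff_prodMk_right t).contDiffOn fun _ hx => ⟨ht, hx⟩

lemma IsVelocity.exists_norm_le {d : ℕ} {Λ : Set (Euc d)} {T : ℝ} {vel : ℝ → Euc d → Euc d}
    (h : IsVelocity Λ T vel) (hΛ : Bornology.IsBounded Λ) :
    ∃ M, 0 ≤ M ∧ ∀ t ∈ Icc 0 T, ∀ x ∈ Λ, ‖vel t x‖ ≤ M := by
  obtain ⟨M, hM⟩ := (isCompact_Icc.prod hΛ.isCompact_closure).exists_bound_of_continuousOn
    h.continuousOn
  exact ⟨max M 0, le_max_right _ _, fun t ht x hx =>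
    (hM (t, x) ⟨ht, subset_closure hx⟩).trans (le_max_left _ _)⟩

lemma abs_compPairing_le {d : ℕ} {Λ : Set (Euc d)} [IsFiniteMeasure (volume.restrict Λ)]
    (hΛ : IsOpen Λ) {g : ℝ → ℝ} (hg : ContDiff ℝ 1 g) {L : ℝ} (hL : ∀ x, |deriv g x| ≤ L)
    (u : H1 Λ) :
    |compPairing g u| ≤ 2 * (‖oneL2 Λ‖ + L) * (|g 0| + ‖u‖) * ‖u‖ := by
  have hL0 : 0 ≤ L := (abs_nonneg _).trans (hL 0)
  obtain ⟨w, h1, h2, h3, h4⟩ := H1.exists_comp hΛ hg hL u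
  rw [← inner_eq_compPairing h1 h2]
  refine (abs_real_inner_le_norm _ _).trans (mul_le_mul_of_nonneg_right ?_ (norm_nonneg _))
  have h5 := H1.norm_le w
  have h6 := mul_le_mul_of_nonneg_left (H1.norm_fn_le u) hL0
  have h7 := mul_le_mul_of_nonneg_left (H1.norm_grad_le u) hL0
  have h8 : 0 ≤ ‖oneL2 Λ‖ * ‖u‖ := by positivity
  have h9 : 0 ≤ L * |g 0| := by positivity
  have h10 : 0 ≤ ‖oneL2 Λ‖ * |g 0| := by positivity
  linarith

/-- Finiteness of `‖Δu‖` matters, since `toReal` sends `∞` to `0`. -/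
lemma ofReal_weight_mul {d : ℕ} {Λ : Set (Euc d)} (r : ℕ) {τ : ℝ} (hτ : 0 ≤ τ) {u u' : H1 Λ}
    (hu : laplacianNorm u ≠ ∞) :
    (∏ l ∈ Finset.Icc 1 r, (‖u‖ₑ ^ (2 ^ l) + ‖u'‖ₑ ^ (2 ^ l)))
        * (‖u - u'‖ₑ ^ 2 + ENNReal.ofReal τ * laplacianNorm u ^ 2)
      = ENNReal.ofReal (weight r ‖u‖ ‖u'‖
          * (‖u - u'‖ ^ 2 + τ * (laplacianNorm u).toReal ^ 2)) := by
  rw [ENNReal.ofReal_mul (weight_nonneg r (norm_nonneg _) (norm_nonneg _)), weight,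
    ENNReal.ofReal_prod_of_nonneg (fun l _ => by positivity),
    ENNReal.ofReal_add (by positivity) (by positivity), ENNReal.ofReal_mul hτ,
    ENNReal.ofReal_pow (norm_nonneg _), ENNReal.ofReal_pow ENNReal.toReal_nonneg,
    ENNReal.ofReal_toReal hu, ofReal_norm]
  congr 1
  refine Finset.prod_congr rfl fun l _ => ?_
  rw [ENNReal.ofReal_add (by positivity) (by positivity), ENNReal.ofReal_pow (norm_nonneg _),
    ENNReal.ofReal_pow (norm_nonneg _), ofReal_norm, ofReal_norm]

lemma pow_two_pow_succ (x : ℝ) (r : ℕ) : x ^ (2 ^ (r + 1)) = (x ^ 2) ^ (2 ^ r) := by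
  rw [pow_succ' 2 r, pow_mul]

lemma weightDeg_add_two (r : ℕ) : weightDeg r + 2 = 2 * 2 ^ r := by
  have := Nat.one_le_two_pow (n := r)
  rw [weightDeg]; omega

lemma add_sq_pow_le (r : ℕ) (γ y : ℝ) :
    (γ ^ 2 + y ^ 2) ^ (2 ^ r) ≤ 2 ^ (2 ^ r) * (|γ| ^ (2 ^ (r + 1)) + y ^ (2 ^ (r + 1))) := by
  rw [pow_two_pow_succ, pow_two_pow_succ, sq_abs]
  exact (add_pow_le (sq_nonneg _) (sq_nonneg _) _).trans (mul_le_mul_of_nonneg_right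
    (pow_le_pow_right₀ one_le_two (Nat.sub_le _ _)) (by positivity))

/-- The coefficient of `δ` in the noise has degree `weightDeg r + 2 = 2^(r+1)`, so the assumed
moment makes it integrable. -/
lemma pow_weightDeg_mul_le (r : ℕ) {γ y : ℝ} (hy : 0 ≤ y) :
    y ^ weightDeg r * ((|γ| + y) * y) ≤ 2 ^ (2 ^ r) * (γ ^ 2 + y ^ 2) ^ (2 ^ r) := by
  have h1 : y ≤ |γ| + y := by linarith [abs_nonneg γ]
  calc y ^ weightDeg r * ((|γ| + y) * y)
      ≤ (|γ| + y) ^ weightDeg r * ((|γ| + y) * (|γ| + y)) := by gcongr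
    _ = ((|γ| + y) ^ 2) ^ (2 ^ r) := by rw [← pow_mul, ← weightDeg_add_two, pow_add]; ring
    _ ≤ (2 * (γ ^ 2 + y ^ 2)) ^ (2 ^ r) := by
        gcongr
        nlinarith [sq_nonneg (|γ| - y), sq_abs γ]
    _ = _ := mul_pow _ _ _

lemma IsEulerScheme.stronglyMeasurable {d : ℕ} {Λ : Set (Euc d)} {T : ℝ} {g f β : ℝ → ℝ}
    {vel : ℝ → Euc d → Euc d} {Ω : Type*} {mΩ : MeasurableSpace Ω} {P : Measure Ω}
    {F : Filtration ℝ≥0 mΩ} {W : ℝ≥0 → Ω → ℝ} {v0 : Ω → H1 Λ} {N : ℕ} {v : ℕ → Ω → H1 Λ}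
    (h : IsEulerScheme Λ T g f β vel P F W v0 N v) (h0 : StronglyMeasurable[F 0] v0)
    {n : ℕ} (hn : n ≤ N) : StronglyMeasurable[F (gridTime T N n).toNNReal] (v n) := by
  rcases Nat.eq_zero_or_pos n with rfl | h1
  · have : (gridTime T N 0).toNNReal = 0 := by simp [gridTime]
    rw [this, h.init]
    exact h0
  · exact h.measurable n (Finset.mem_Icc.2 ⟨h1, hn⟩)

/-- The estimate for one step of the scheme. -/
lemma exists_step_estimate {d : ℕ} {Λ : Set (Euc d)} (hΛo : IsOpen Λ)
    (hΛb : Bornology.IsBounded Λ) {T : ℝ} (hT : 0 < T)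
    {g f β : ℝ → ℝ} (hg : IsC2Bounded g) (hf : IsC2Bounded f) (hβ : IsC2Bounded β) (hβ0 : β 0 = 0)
    {vel : ℝ → Euc d → Euc d} (hvel : IsVelocity Λ T vel) (r : ℕ) :
    ∃ τ₀ : ℝ, 0 < τ₀ ∧ ∃ Θ : ℝ, 0 ≤ Θ ∧
      ∀ (Ω : Type*) (mΩ : MeasurableSpace Ω) (P : Measure Ω) (_ : IsProbabilityMeasure P)
        (F : Filtration ℝ≥0 mΩ) (W : ℝ≥0 → Ω → ℝ) (_ : IsBrownianFor F W P)
        (v0 : Ω → H1 Λ) (_ : StronglyMeasurable[F 0] v0) (N : ℕ) (_ : 0 < N) (_ : T / N ≤ τ₀)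
        (v : ℕ → Ω → H1 Λ) (_ : IsEulerScheme Λ T g f β vel P F W v0 N v),
        ∀ n ∈ Finset.Icc 1 N, Integrable (fun ω => ‖v (n - 1) ω‖ ^ (2 ^ (r + 1))) P →
          Integrable (fun ω => ‖v n ω‖ ^ (2 ^ (r + 1))) P ∧
          ENNReal.ofReal (∫ ω, ‖v n ω‖ ^ (2 ^ (r + 1)) ∂P)
            + ENNReal.ofReal (1 / 4) * ∫⁻ ω,
                (∏ l ∈ Finset.Icc 1 r, (‖v n ω‖ₑ ^ (2 ^ l) + ‖v (n - 1) ω‖ₑ ^ (2 ^ l)))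
                  * (‖v n ω - v (n - 1) ω‖ₑ ^ 2
                    + ENNReal.ofReal (T / N) * laplacianNorm (v n ω) ^ 2) ∂P
          ≤ ENNReal.ofReal (∫ ω, ‖v (n - 1) ω‖ ^ (2 ^ (r + 1)) ∂P
              + Θ * (T / N) * (|g 0| ^ (2 ^ (r + 1))
                + ∫ ω, ‖v (n - 1) ω‖ ^ (2 ^ (r + 1)) ∂P)) := by
  have : IsFiniteMeasure (volume.restrict Λ) := ⟨by
    rw [Measure.restrict_apply_univ]; exact hΛb.measure_lt_top⟩
  obtain ⟨Lg, hLg⟩ := hg.2.1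
  obtain ⟨Lf, hLf⟩ := hf.2.1
  obtain ⟨Lβ, hLβ⟩ := hβ.2.1
  have hLf0 : 0 ≤ Lf := (abs_nonneg _).trans (hLf 0)
  have hLβ0 : 0 ≤ Lβ := (abs_nonneg _).trans (hLβ 0)
  obtain ⟨M, hM0, hM⟩ := hvel.exists_norm_le hΛb
  obtain ⟨C₀, hC₀⟩ : ∃ C₀, C₀ = 2 * (Lf * M + Lβ) + (Lf * M + Lβ) ^ 2 := ⟨_, rfl⟩
  have hC₀0 : 0 ≤ C₀ := by rw [hC₀]; positivity
  obtain ⟨C, hC, hpow⟩ := exists_energy_pow r (C₁ := ‖oneL2 Λ‖ + 2 * Lg) hC₀0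
  obtain ⟨K, hK, hgauss⟩ := exists_gaussian_moment_le hT.le (2 ^ r)
  -- The step size bound ensures `C₀τ ≤ 1/2`. In `Θ`, `C` is the pathwise constant, `K` the Gaussian
  -- moment, and `2 ^ (2 ^ r)` comes from separating `g 0` and `‖u'‖`.
  refine ⟨1 / (2 * (C₀ + 1)), by positivity, C * K * 2 ^ (2 ^ r), by positivity, ?_⟩
  intro Ω mΩ P _ F W hW v0 hv0 N hN hNτ v hv n hn hint
  obtain ⟨hn1, hnN⟩ := Finset.mem_Icc.1 hn
  have hN' : (0 : ℝ) < N := by exact_mod_cast hN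
  have hτ : 0 < T / N := by positivity
  have hτC : C₀ * (T / N) ≤ 1 / 2 := by
    calc C₀ * (T / N) ≤ C₀ * (1 / (2 * (C₀ + 1))) := by gcongr
      _ ≤ 1 / 2 := by
        rw [mul_one_div, div_le_div_iff₀ (by positivity) two_pos]; linarith
  obtain ⟨t, htdef⟩ : ∃ t, t = gridTime T N n := ⟨_, rfl⟩
  obtain ⟨s, hsdef⟩ : ∃ s, s = gridTime T N (n - 1) := ⟨_, rfl⟩
  have hs0 : 0 ≤ s := by rw [hsdef, gridTime]; positivity
  have hts : t = s + T / N := by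
    rw [htdef, hsdef, gridTime, gridTime, Nat.cast_sub hn1]; push_cast; ring
  have ht0 : 0 ≤ t := by rw [hts]; positivity
  have htT : t ≤ T := by
    rw [htdef, gridTime, div_le_iff₀ hN', mul_comm]
    gcongr
  -- the increment of the noise
  obtain ⟨δ, hδdef⟩ : ∃ δ : Ω → ℝ, δ = fun ω => W t.toNNReal ω - W s.toNNReal ω := ⟨_, rfl⟩
  obtain ⟨w, hw⟩ : ∃ w : ℝ≥0, w = nndist t.toNNReal.1 s.toNNReal.1 := ⟨_, rfl⟩
  have hwτ : (w : ℝ) = T / N := by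
    rw [hw, coe_nndist, Real.dist_eq]
    change |(t.toNNReal : ℝ) - (s.toNNReal : ℝ)| = _
    rw [Real.coe_toNNReal t ht0, Real.coe_toNNReal s hs0, hts, add_sub_cancel_left,
      abs_of_pos hτ]
  have hδ : HasLaw δ (gaussianReal 0 w) P := by
    rw [hw, hδdef]
    exact hW.isBrownian.hasLaw_sub t.toNNReal s.toNNReal
  have hind : Indep (MeasurableSpace.comap δ inferInstance) (F s.toNNReal) P := by
    rw [hδdef]
    exact hW.indep _ _ (Real.toNNReal_le_toNNReal (by linarith))
  have hwT : (w : ℝ) ≤ T := by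
    rw [hwτ]
    exact div_le_self hT.le (by exact_mod_cast hN)
  obtain ⟨hψi, hψK⟩ := hgauss w hwT
  -- measurability
  have hvn : StronglyMeasurable (v n) := (hv.stronglyMeasurable hv0 hnN).mono (F.le _)
  have hvp : StronglyMeasurable[F s.toNNReal] (v (n - 1)) := by
    rw [hsdef]; exact hv.stronglyMeasurable hv0 (by omega)
  have hX : Measurable[F s.toNNReal] fun ω => 2 * weight r ‖v (n - 1) ω‖ ‖v (n - 1) ω‖
      * compPairing g (v (n - 1) ω) := by
    have hc : Continuous fun u : H1 Λ => 2 * weight r ‖u‖ ‖u‖ * compPairing g u := by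
      simp only [weight_self]
      exact (continuous_const.mul (continuous_const.mul (continuous_norm.pow _))).mul
        (continuous_compPairing hg.contDiff_one hLg)
    exact (hc.comp_stronglyMeasurable hvp).measurable
  have hY : Measurable[F s.toNNReal] fun ω => ((g 0) ^ 2 + ‖v (n - 1) ω‖ ^ 2) ^ (2 ^ r) := by
    have hc : Continuous fun u : H1 Λ => ((g 0) ^ 2 + ‖u‖ ^ 2) ^ (2 ^ r) := by fun_prop
    exact (hc.comp_stronglyMeasurable hvp).measurable
  have hbound : Integrable (fun ω => 2 ^ (2 ^ r)
      * (|g 0| ^ (2 ^ (r + 1)) + ‖v (n - 1) ω‖ ^ (2 ^ (r + 1)))) P :=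
    ((integrable_const _).add hint).const_mul _
  have hYi : Integrable (fun ω => ((g 0) ^ 2 + ‖v (n - 1) ω‖ ^ 2) ^ (2 ^ r)) P := by
    refine hbound.mono' (hY.mono (F.le _) le_rfl).aestronglyMeasurable
      (Filter.Eventually.of_forall fun ω => ?_)
    rw [Real.norm_of_nonneg (by positivity)]
    exact add_sq_pow_le r _ _
  have hXi : Integrable (fun ω => 2 * weight r ‖v (n - 1) ω‖ ‖v (n - 1) ω‖
      * compPairing g (v (n - 1) ω)) P := by
    refine (hYi.const_mul (2 * 2 ^ r * (2 * (‖oneL2 Λ‖ + Lg)) * 2 ^ (2 ^ r))).mono'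
      (hX.mono (F.le _) le_rfl).aestronglyMeasurable (Filter.Eventually.of_forall fun ω => ?_)
    have hLg0 : 0 ≤ Lg := (abs_nonneg _).trans (hLg 0)
    rw [weight_self, norm_mul, Real.norm_of_nonneg (by positivity), Real.norm_eq_abs]
    calc _ ≤ 2 * (2 ^ r * ‖v (n - 1) ω‖ ^ weightDeg r)
          * (2 * (‖oneL2 Λ‖ + Lg) * (|g 0| + ‖v (n - 1) ω‖) * ‖v (n - 1) ω‖) := by
          gcongr
          exact abs_compPairing_le hΛo hg.contDiff_one hLg _
      _ = 2 * 2 ^ r * (2 * (‖oneL2 Λ‖ + Lg)) * (‖v (n - 1) ω‖ ^ weightDeg r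
          * ((|g 0| + ‖v (n - 1) ω‖) * ‖v (n - 1) ω‖)) := by ring
      _ ≤ 2 * 2 ^ r * (2 * (‖oneL2 Λ‖ + Lg)) * (2 ^ (2 ^ r)
          * ((g 0) ^ 2 + ‖v (n - 1) ω‖ ^ 2) ^ (2 ^ r)) := by
          gcongr ?_ * ?_
          exact pow_weightDeg_mul_le r (norm_nonneg _)
      _ = _ := by ring
  have hstep : ∀ᵐ ω ∂P, laplacianNorm (v n ω) ≠ ∞ ∧
      ‖v n ω‖ ^ (2 ^ (r + 1)) + 1 / 4 * (weight r ‖v n ω‖ ‖v (n - 1) ω‖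
        * (‖v n ω - v (n - 1) ω‖ ^ 2 + T / N * (laplacianNorm (v n ω)).toReal ^ 2))
      ≤ ‖v (n - 1) ω‖ ^ (2 ^ (r + 1)) + δ ω * (2 * weight r ‖v (n - 1) ω‖ ‖v (n - 1) ω‖
        * compPairing g (v (n - 1) ω))
        + C * ((δ ω ^ 2 + w) * (1 + δ ω ^ 2) ^ (2 ^ r))
          * ((g 0) ^ 2 + ‖v (n - 1) ω‖ ^ 2) ^ (2 ^ r) := by
    filter_upwards [hv.step n hn] with ω hω
    rw [← htdef, ← hsdef] at hω
    have htI : t ∈ Icc 0 T := ⟨ht0, htT⟩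
    obtain ⟨h1, G, h2, h3, h4⟩ := hω.energy hΛo hg.contDiff_one hLg hf.contDiff_one hLf
      hβ.contDiff_one hLβ hβ0 (hvel.contDiffOn_slice htI) hM0 (hM t htI)
      (hvel.div_eq_zero t htI) hτ
    refine ⟨h1, ?_⟩
    rw [← hC₀] at h4
    have h5 := hpow _ _ G (T / N) _ (laplacianNorm (v n ω)).toReal (g 0) hτ.le hτC h3 h4
    rw [hwτ, ← h2, hδdef]
    exact h5
  have hmain := lintegral_energy_le (m := F s.toNNReal) (P := P) hδ hind
    (ψ := fun x => (x ^ 2 + w) * (1 + x ^ 2) ^ (2 ^ r)) (by fun_prop) hψi hψK hC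
    (a := fun ω => ‖v n ω‖ ^ (2 ^ (r + 1))) (b := fun ω => ‖v (n - 1) ω‖ ^ (2 ^ (r + 1)))
    (w := fun ω => weight r ‖v n ω‖ ‖v (n - 1) ω‖
        * (‖v n ω - v (n - 1) ω‖ ^ 2 + T / N * (laplacianNorm (v n ω)).toReal ^ 2))
    (hvn.norm.pow _).aestronglyMeasurable (fun ω => by positivity)
    (fun ω => mul_nonneg (weight_nonneg r (norm_nonneg _) (norm_nonneg _)) (by positivity))
    hint hX hXi hY hYi (fun ω => by positivity) (hstep.mono fun ω hω => hω.2)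
  refine ⟨hmain.1, le_trans (le_of_eq ?_) (hmain.2.trans (ENNReal.ofReal_le_ofReal ?_))⟩
  · congr 2
    refine lintegral_congr_ae (hstep.mono fun ω hω => ?_)
    exact ofReal_weight_mul r hτ.le hω.1
  · have hYle : ∫ ω, ((g 0) ^ 2 + ‖v (n - 1) ω‖ ^ 2) ^ (2 ^ r) ∂P
        ≤ 2 ^ (2 ^ r) * (|g 0| ^ (2 ^ (r + 1)) + ∫ ω, ‖v (n - 1) ω‖ ^ (2 ^ (r + 1)) ∂P) := by
      refine (integral_mono hYi hbound fun ω => add_sq_pow_le r _ _).trans (le_of_eq ?_)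
      rw [integral_const_mul, integral_add (integrable_const _) hint]
      simp
    rw [hwτ]
    calc _ ≤ ∫ ω, ‖v (n - 1) ω‖ ^ (2 ^ (r + 1)) ∂P + C * (K * (T / N)) * (2 ^ (2 ^ r)
          * (|g 0| ^ (2 ^ (r + 1)) + ∫ ω, ‖v (n - 1) ω‖ ^ (2 ^ (r + 1)) ∂P)) := by gcongr
      _ = _ := by ring

end

/-! ### Summation over the time steps -/

theorem mainTheorem4 {d : ℕ} (hd : d = 2 ∨ d = 3)
    (Λ : Set (Euc d)) (hΛo : IsOpen Λ) (hΛb : Bornology.IsBounded Λ) (hΛc : IsConnected Λ)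
    (hΛp : IsPolygonal Λ) (T : ℝ) (hT : 0 < T)
    (g f β : ℝ → ℝ) (hg : IsC2Bounded g)
    (hf : IsC2Bounded f) (hfm : Monotone f) (hf0 : f 0 = 0)
    (hβ : IsC2Bounded β) (hβ0 : β 0 = 0)
    (vel : ℝ → Euc d → Euc d) (hvel : IsVelocity Λ T vel) (r : ℕ) :
    ∃ Nr : ℕ, 0 < Nr ∧ ∃ C : ℝ, 0 < C ∧
      ∀ (Ω : Type*) (mΩ : MeasurableSpace Ω) (P : Measure Ω) (_ : IsProbabilityMeasure P)
        (F : Filtration ℝ≥0 mΩ) (_ : UsualConditions F P)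
        (W : ℝ≥0 → Ω → ℝ) (_ : IsBrownianFor F W P)
        (v0 : Ω → H1 Λ) (_ : StronglyMeasurable[F 0] v0) (_ : MemLp v0 (2 ^ (r + 1)) P),
        ∃ K : ℝ, 0 < K ∧
          ∀ N : ℕ, Nr ≤ N → ∀ v : ℕ → Ω → H1 Λ, IsEulerScheme Λ T g f β vel P F W v0 N v →
            (⨆ n ∈ Finset.Icc 1 N, ∫⁻ ω, ‖v n ω‖ₑ ^ (2 ^ (r + 1)) ∂P)
              + ∑ n ∈ Finset.Icc 1 N, ∫⁻ ω,
                  (∏ l ∈ Finset.Icc 1 r, (‖v n ω‖ₑ ^ (2 ^ l) + ‖v (n - 1) ω‖ₑ ^ (2 ^ l)))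
                    * (‖v n ω - v (n - 1) ω‖ₑ ^ 2
                      + ENNReal.ofReal (T / N) * laplacianNorm (v n ω) ^ 2) ∂P
              ≤ ENNReal.ofReal C *
                  (ENNReal.ofReal (|g 0| ^ (2 ^ (r + 1)))
                    + ∫⁻ ω, ‖v0 ω‖ₑ ^ (2 ^ (r + 1)) ∂P) ∧
            ENNReal.ofReal C *
                  (ENNReal.ofReal (|g 0| ^ (2 ^ (r + 1)))
                    + ∫⁻ ω, ‖v0 ω‖ₑ ^ (2 ^ (r + 1)) ∂P)
              ≤ ENNReal.ofReal K := by
  obtain ⟨τ₀, hτ₀, Θ, hΘ, hstep⟩ := exists_step_estimate hΛo hΛb hT hg hf hβ hβ0 hvel r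
  -- `N ≥ T / τ₀` makes the time step admissible; the constant adds Gronwall's bounds for the
  -- supremum and for the sum.
  refine ⟨⌈T / τ₀⌉₊ + 1, by omega,
    Real.exp (Θ * T) + 4 * (1 + Θ * T * Real.exp (Θ * T)), by positivity, ?_⟩
  intro Ω mΩ P _ F _ W hW v0 hv0 hv0L
  have hint0 : Integrable (fun ω => ‖v0 ω‖ ^ (2 ^ (r + 1))) P := by
    refine MemLp.integrable_norm_pow' ?_
    exact_mod_cast hv0L
  have hpow : ∀ x : H1 Λ, ‖x‖ₑ ^ (2 ^ (r + 1)) = ENNReal.ofReal (‖x‖ ^ (2 ^ (r + 1))) := fun x => by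
    rw [ENNReal.ofReal_pow (norm_nonneg _), ofReal_norm]
  have hlint : ∀ {u : Ω → H1 Λ}, Integrable (fun ω => ‖u ω‖ ^ (2 ^ (r + 1))) P →
      ∫⁻ ω, ‖u ω‖ₑ ^ (2 ^ (r + 1)) ∂P = ENNReal.ofReal (∫ ω, ‖u ω‖ ^ (2 ^ (r + 1)) ∂P) :=
    fun {u} hu => by
      rw [ofReal_integral_eq_lintegral_ofReal hu
        (Filter.Eventually.of_forall fun ω => by positivity)]
      simp_rw [hpow]
  have hA0 : 0 ≤ ∫ ω, ‖v0 ω‖ ^ (2 ^ (r + 1)) ∂P := integral_nonneg fun ω => by positivity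
  obtain ⟨D, hD⟩ : ∃ D, D = Real.exp (Θ * T) + 4 * (1 + Θ * T * Real.exp (Θ * T)) := ⟨_, rfl⟩
  have hD0 : 0 ≤ D := by rw [hD]; positivity
  have hrhs : ENNReal.ofReal D * (ENNReal.ofReal (|g 0| ^ (2 ^ (r + 1)))
      + ∫⁻ ω, ‖v0 ω‖ₑ ^ (2 ^ (r + 1)) ∂P)
      = ENNReal.ofReal (D * (|g 0| ^ (2 ^ (r + 1)) + ∫ ω, ‖v0 ω‖ ^ (2 ^ (r + 1)) ∂P)) := by
    rw [hlint hint0, ENNReal.ofReal_mul hD0, ENNReal.ofReal_add (by positivity) hA0]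
  rw [← hD, hrhs]
  refine ⟨D * (|g 0| ^ (2 ^ (r + 1)) + ∫ ω, ‖v0 ω‖ ^ (2 ^ (r + 1)) ∂P) + 1, by positivity, ?_⟩
  intro N hN v hv
  refine ⟨?_, ENNReal.ofReal_le_ofReal (by linarith)⟩
  have hN0 : 0 < N := by omega
  have hN' : (0 : ℝ) < N := by exact_mod_cast hN0
  have hNτ : T / N ≤ τ₀ := by
    rw [div_le_comm₀ hN' hτ₀]
    calc T / τ₀ ≤ ⌈T / τ₀⌉₊ := Nat.le_ceil _
      _ ≤ N := by exact_mod_cast (by omega : ⌈T / τ₀⌉₊ ≤ N)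
  have hone := hstep Ω mΩ P ‹_› F W hW v0 hv0 N hN0 hNτ v hv
  -- The scheme only provides second moments; the higher ones propagate from `v0` step by step.
  have hint : ∀ n ≤ N, Integrable (fun ω => ‖v n ω‖ ^ (2 ^ (r + 1))) P := by
    intro n
    induction n with
    | zero => intro _; rw [hv.init]; exact hint0
    | succ n ih =>
      exact fun hn => (hone (n + 1) (Finset.mem_Icc.2 ⟨by omega, hn⟩) (ih (by omega))).1
  have hAn : ∀ n, 0 ≤ ∫ ω, ‖v n ω‖ ^ (2 ^ (r + 1)) ∂P := fun n =>
    integral_nonneg fun ω => by positivity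
  -- The one-step bound has a finite right-hand side, so Gronwall's inequality can be applied to
  -- real numbers.
  have hsum_finite : ∀ n ∈ Finset.Icc 1 N, (∫⁻ ω,
      (∏ l ∈ Finset.Icc 1 r, (‖v n ω‖ₑ ^ (2 ^ l) + ‖v (n - 1) ω‖ₑ ^ (2 ^ l)))
        * (‖v n ω - v (n - 1) ω‖ₑ ^ 2
          + ENNReal.ofReal (T / N) * laplacianNorm (v n ω) ^ 2) ∂P) ≠ ∞ := by
    intro n hn htop
    have h1 := (hone n hn (hint _ (by have := (Finset.mem_Icc.1 hn).2; omega))).2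
    rw [htop, ENNReal.mul_top (by simp), add_top, top_le_iff] at h1
    exact ENNReal.ofReal_ne_top h1
  obtain ⟨hmax, hsum⟩ := energy_gronwall (N := N) (τ := T / N) (T := T) (Θ := Θ)
    (Γ := |g 0| ^ (2 ^ (r + 1))) (by positivity) (mul_div_cancel₀ _ hN'.ne') hΘ (by positivity)
    (A := fun n => ∫ ω, ‖v n ω‖ ^ (2 ^ (r + 1)) ∂P)
    (S := fun n => (∫⁻ ω,
      (∏ l ∈ Finset.Icc 1 r, (‖v n ω‖ₑ ^ (2 ^ l) + ‖v (n - 1) ω‖ₑ ^ (2 ^ l)))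
        * (‖v n ω - v (n - 1) ω‖ₑ ^ 2
          + ENNReal.ofReal (T / N) * laplacianNorm (v n ω) ^ 2) ∂P).toReal)
    hAn (fun n => ENNReal.toReal_nonneg) (fun n hn => by
      have h1 := (hone n hn (hint _ (by have := (Finset.mem_Icc.1 hn).2; omega))).2
      have h2 := hAn (n - 1)
      rw [← ENNReal.ofReal_toReal (hsum_finite n hn), ← ENNReal.ofReal_mul (by norm_num),
        ← ENNReal.ofReal_add (hAn n) (by positivity),
        ENNReal.ofReal_le_ofReal_iff (by positivity)] at h1
      exact h1)
  rw [hv.init] at hmax hsum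
  rw [hD, add_mul, ENNReal.ofReal_add (by positivity) (by positivity)]
  refine add_le_add (iSup₂_le fun n hn => ?_) ?_
  · have hnN := (Finset.mem_Icc.1 hn).2
    rw [hlint (hint n hnN)]
    exact ENNReal.ofReal_le_ofReal (hmax n hnN)
  · refine le_trans (le_of_eq ?_) (ENNReal.ofReal_le_ofReal hsum)
    rw [ENNReal.ofReal_sum_of_nonneg fun n _ => ENNReal.toReal_nonneg]
    exact Finset.sum_congr rfl fun n hn => (ENNReal.ofReal_toReal (hsum_finite n hn)).symm
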